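/- Let $v=v_0v_1v_2\ldots$ be the Thue–Morse word over the alphabet $\{1,-1\}$, that is, the fixed point with $v_0=1$ of the substitution $1\mapsto 1\,{-1}$, $-1\mapsto {-1}\,1$. Let $w\in\{\pm1\}^{\mathbb Z}$ be the two-sided word with $w_n=v_n$ for $n\ge 0$ and $w_n=v_{-n-1}$ for $n<0$, and let $\mathbb X$ be its hull, the closure in the product topology of the orbit of $w$ under the two-sided shift. (1) For every $m\in\mathbb Z$ the limit $$\eta(m)=\lim_{N\to\infty}\frac1{2N+1}\sum_{\substack{-N\le k,\ell\le N\\ k-\ell=m}}w_kw_\ell=\lim_{N\to\infty}\frac1{2N+1}\sum_{n=-N}^{N}w_nw_{n-m}$$ exists. For every $x\in\mathbb X$ the same limits with $x$ in place of $w$ exist and are equal to $\eta(m)$, and $\gamma=\sum_{m\in\mathbb Z}\eta(m)\,\delta_m$ is the autocorrelation measure of the Dirac comb $\omega_x=\sum_{n\in\mathbb Z}x_n\delta_n$ on $\mathbb R$: it is the vague limit, as $N\to\infty$, of $\frac1{2N+1}\,\omega_{x,N}*\widetilde{\omega_{x,N}}$, where $\omega_{x,N}=\sum_{n=-N}^{N}x_n\delta_n$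 and $\widetilde{\omega_{x,N}}=\sum_{n=-N}^{N}x_n\delta_{-n}$. (2) There is a unique finite positive measure $\nu$ on $[0,1)$ with $\eta(m)=\int_0^1 e^{2\pi i m y}\,\mathrm d\nu(y)$ for all $m\in\mathbb Z$. This measure is nonzero and purely singular continuous: it has no point masses and is singular with respect to Lebesgue measure. (3) Put $\delta_{\mathbb Z}=\sum_{n\in\mathbb Z}\delta_n$. The diffraction measure $\widehat\gamma$, i.e. the unique positive measure on $\mathbb R$ that is the Fourier transform of $\gamma$ in the sense of tempered distributions, exists and is $\widehat\gamma=\nu*\delta_{\mathbb Z}$. Its restriction to $[0,1)$ is $\nu$. It is a locally finite, positive, $\mathbb Z$-periodic, purely singular continuous measure on $\mathbb R$. By (1), it is the same for the Dirac combs of all members of $\mathbb X$. -/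

import Mathlib

open MeasureTheory Filter Topology
open scoped FourierTransform SchwartzMap

noncomputable section

namespace ThueMorse

/-! ## The Thue–Morse words and their hull

The alphabet `{1, 1̄}` is realised as `ℤˣ = {1, -1}`, with `1̄ = -1`. -/

/-- The Thue–Morse substitution `1 ↦ 1 1̄`, `1̄ ↦ 1̄ 1` on letters. -/
def substLetter (a : ℤˣ) : Fin 2 → ℤˣ := ![a, -a]

/-- The substitution acting on one-sided infinite words: the images of the successive letters
are concatenated, so the letter at position `n` is the letter number `n % 2` in the image of the
letter at position `n / 2`. -/
def substWord (u : ℕ → ℤˣ) (n : ℕ) : ℤˣ :=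
  substLetter (u (n / 2)) ⟨n % 2, Nat.mod_lt n two_pos⟩

/-- The one-sided Thue–Morse word `v = v₀ v₁ v₂ …`, the fixed point of the substitution that
starts with `v₀ = 1`; see `isFixedPt_oneSided` and `eq_oneSided`. -/
def oneSided : ℕ → ℤˣ
  | 0 => 1
  | n + 1 => substLetter (oneSided ((n + 1) / 2)) ⟨(n + 1) % 2, Nat.mod_lt _ two_pos⟩
decreasing_by omega

theorem oneSided_zero : oneSided 0 = 1 := by
  rw [oneSided]

theorem isFixedPt_oneSided : substWord oneSided = oneSided := by
  funext n
  cases n with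
  | zero => simp [substWord, oneSided_zero, substLetter]
  | succ n =>
    conv_rhs => rw [oneSided]
    rfl

/-- `oneSided` is the only fixed point of the substitution with first letter `1`. -/
theorem eq_oneSided (u : ℕ → ℤˣ) (h0 : u 0 = 1) (hu : substWord u = u) : u = oneSided := by
  funext n
  induction n using Nat.strong_induction_on with
  | _ n ih =>
    cases n with
    | zero => rw [h0, oneSided_zero]
    | succ n =>
      rw [← hu, ← isFixedPt_oneSided]
      simp only [substWord]
      rw [ih ((n + 1) / 2) (by omega)]

/-- The reflection-symmetric two-sided Thue–Morse word: `w n = v n` for `n ≥ 0` and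
`w n = v (-n - 1)` for `n < 0`. -/
def twoSided (n : ℤ) : ℤˣ :=
  if 0 ≤ n then oneSided n.toNat else oneSided (-n - 1).toNat

/-- The `m`-th power of the two-sided shift, `(S ^ m x) n = x (n + m)`. -/
def shift (m : ℤ) (x : ℤ → ℤˣ) : ℤ → ℤˣ := fun n => x (n + m)

/-- The Thue–Morse hull: the closure of the shift orbit of `w` in the product topology
(each factor `ℤˣ` being discrete). -/
def hull : Set (ℤ → ℤˣ) := closure (Set.range fun m : ℤ => shift m twoSided)

/-! ## Weighted Dirac combs, autocorrelation and diffraction -/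

/-- The real weights `±1` of a two-sided word. -/
def weight (x : ℤ → ℤˣ) (n : ℤ) : ℝ := ((x n : ℤ) : ℝ)

/-- The integral of `f` against the weighted Dirac comb `∑ n, c n • δ_n` on `ℝ`. -/
def combIntegral (c : ℤ → ℝ) (f : ℝ → ℂ) : ℂ := ∑' n : ℤ, (c n : ℂ) * f (n : ℝ)

/-- The weights of the comb restricted to the window `[-(N + 1/2), N + 1/2]` of length `2N + 1`,
which contains exactly the integers `-N, …, N`. -/
def truncate (c : ℤ → ℝ) (N : ℕ) (n : ℤ) : ℝ := if |n| ≤ (N : ℤ) then c n else 0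

/-- The integral of `f` against the volume-averaged convolution `(2N + 1)⁻¹ • (ω_N ∗ ω̃_N)`, where
`ω_N` is the comb with weights `c` restricted to the window of length `2N + 1`, and `ω̃_N` is its
reflection in the origin. -/
def averagedConvolution (c : ℤ → ℝ) (N : ℕ) (f : ℝ → ℂ) : ℂ :=
  ((2 * N + 1 : ℝ) : ℂ)⁻¹ *
    combIntegral (truncate c N) fun s => combIntegral (truncate c N) fun t => f (s - t)

/-- The comb with weights `e` is the autocorrelation of the comb with weights `c`: it is the limit
of the volume-averaged convolutions in the vague topology. -/
def IsAutocorrelation (c e : ℤ → ℝ) : Prop :=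
  ∀ f : ℝ → ℂ, Continuous f → HasCompactSupport f →
    Tendsto (fun N : ℕ => averagedConvolution c N f) atTop (𝓝 (combIntegral e f))

/-- `(2N + 1)⁻¹ ∑ c k * c l`, summed over `-N ≤ k, l ≤ N` with `k - l = m`. -/
def pairAverage (c : ℤ → ℝ) (m : ℤ) (N : ℕ) : ℝ :=
  (2 * N + 1 : ℝ)⁻¹ *
    ∑ p ∈ (Finset.Icc (-(N : ℤ)) N ×ˢ Finset.Icc (-(N : ℤ)) N) with p.1 - p.2 = m, c p.1 * c p.2

/-- `(2N + 1)⁻¹ ∑ c n * c (n - m)`, summed over `-N ≤ n ≤ N`. -/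
def siteAverage (c : ℤ → ℝ) (m : ℤ) (N : ℕ) : ℝ :=
  (2 * N + 1 : ℝ)⁻¹ * ∑ n ∈ Finset.Icc (-(N : ℤ)) N, c n * c (n - m)

/-- The Thue–Morse autocorrelation coefficients `η m`. The existence of the limit is part of
the theorem. -/
def eta (m : ℤ) : ℝ := limUnder atTop (pairAverage (weight twoSided) m)

/-- `ν` is a finite positive measure on `[0, 1)` with `∫ exp (2 π i m y) dν(y) = e m` for all
integers `m`. -/
def HasFourierCoefficients (ν : Measure ℝ) (e : ℤ → ℝ) : Prop :=
  IsFiniteMeasure ν ∧ ν (Set.Ico (0 : ℝ) 1)ᶜ = 0 ∧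
    ∀ m : ℤ, ∫ y, Complex.exp (2 * Real.pi * Complex.I * m * y) ∂ν = (e m : ℂ)

/-- The positive measure `μ` is the Fourier transform, in the sense of tempered distributions, of
the Dirac comb with weights `e`: `∫ φ dμ = ∑ m, e m * φ̂(m)` for all Schwartz functions `φ`, where
`φ̂(k) = ∫ exp (-2 π i k x) φ(x) dx`. -/
def IsCombFourierTransform (e : ℤ → ℝ) (μ : Measure ℝ) : Prop :=
  ∀ φ : 𝓢(ℝ, ℂ), Integrable (fun x => φ x) μ ∧
    HasSum (fun m : ℤ => (e m : ℂ) * 𝓕 (fun x : ℝ => φ x) (m : ℝ)) (∫ x, φ x ∂μ)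

/-- `δ_ℤ`, the sum of the unit point masses at the integers. -/
def deltaZ : Measure ℝ := Measure.sum fun n : ℤ => Measure.dirac (n : ℝ)

/-- A positive measure on `ℝ` is purely singular continuous if it has no point masses and
is singular with respect to Lebesgue measure. -/
def IsPurelySingularContinuous (μ : Measure ℝ) : Prop :=
  (∀ x : ℝ, μ {x} = 0) ∧ μ ⟂ₘ (volume : Measure ℝ)

end ThueMorse

end

/-! All three parts rest on a dyadic recursion for the correlations. Splitting sites into pairs `2 *
k`, `2 * k + 1` expresses the products at distance `2 * j` through those at distance `j`, and at
distance `2 * j + 1` through those at `j` and `j + 1`, up to finitely many `k` near the seam at the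
origin. Hence the coefficients satisfy η(2m) = η(m) and η(2m+1) = -(η(m) + η(m+1))/2. The means
exist uniformly in the position of the window (`UniformMean`), and this uniformity is what carries
the same limits to every member of the hull.

The measure ν is a weak limit of the normalised intensities |∑ w_n e(-ny)|²/(2N+1), where e(t) =
exp(2πit); their Fourier coefficients are exactly the finite averages `pairAverage`
(`exists_circleMeasure`). Uniqueness is density of trigonometric polynomials.

Both spectral statements use one L² estimate, `integral_norm_sq_sum_le`: functions whose inner
products are bounded by h(k-j) have ‖∑_{k<N} X_k‖² ≤ 2N ∑_{d<N} h(d). Singularity: the averages of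
e(2^k y) over k < N tend to -1/3 in L²(ν), because η(2^k) = -1/3 and the covariances decay like
2^{-(k-j)}; in L² of Lebesgue measure on [0,1) they tend to 0. So no nonzero measure lies below
both. No point masses: N ν{y} ≤ 2 ∑_{d<N} |η(d)|, and the recursion gives ∑_{d<4^k} |η(d)| ≤ 3^k.

The diffraction formula is Poisson summation integrated against ν, and the transform is unique
because smooth bumps determine the mass of every interval. -/

noncomputable section

namespace ThueMorse

/-! ## Uniform means of bounded sequences over `ℤ` -/

/-- The averages of `f` over windows of length `L` tend to `e`, uniformly in the position of the
window. -/
def UniformMean (f : ℤ → ℝ) (e : ℝ) : Prop :=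
  ∀ ε > 0, ∃ C : ℝ, ∀ (a : ℤ) (L : ℕ),
    |∑ n ∈ Finset.range L, f (a + n) - L * e| ≤ ε * L + C

theorem UniformMean.const (c : ℝ) : UniformMean (fun _ => c) c := by
  intro ε hε
  refine ⟨0, fun a L => ?_⟩
  simp
  positivity

theorem UniformMean.add {f g : ℤ → ℝ} {d e : ℝ} (hf : UniformMean f d) (hg : UniformMean g e) :
    UniformMean (fun n => f n + g n) (d + e) := by
  intro ε hε
  obtain ⟨C, hC⟩ := hf (ε / 2) (by positivity)
  obtain ⟨D, hD⟩ := hg (ε / 2) (by positivity)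
  refine ⟨C + D, fun a L => ?_⟩
  rw [Finset.sum_add_distrib]
  have h1 := abs_le.1 (hC a L)
  have h2 := abs_le.1 (hD a L)
  rw [abs_le]
  constructor <;> linarith [h1.1, h1.2, h2.1, h2.2]

theorem UniformMean.neg {f : ℤ → ℝ} {e : ℝ} (hf : UniformMean f e) :
    UniformMean (fun n => -f n) (-e) := by
  intro ε hε
  obtain ⟨C, hC⟩ := hf ε hε
  refine ⟨C, fun a L => ?_⟩
  rw [Finset.sum_neg_distrib, ← abs_neg]
  convert hC a L using 2
  ring

theorem UniformMean.comp_add {f : ℤ → ℝ} {e : ℝ} (hf : UniformMean f e) (c : ℤ) :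
    UniformMean (fun n => f (n + c)) e := by
  intro ε hε
  obtain ⟨C, hC⟩ := hf ε hε
  refine ⟨C, fun a L => ?_⟩
  simpa only [add_right_comm a c] using hC (a + c) L

theorem sum_abs_window_le (h : ℤ → ℝ) (F : Finset ℤ) (hF : ∀ n ∉ F, h n = 0) (a : ℤ) (L : ℕ) :
    |∑ n ∈ Finset.range L, h (a + n)| ≤ ∑ n ∈ F, |h n| := by
  refine (Finset.abs_sum_le_sum_abs _ _).trans ?_
  have : ∑ n ∈ Finset.range L, |h (a + n)| =
      ∑ n ∈ (Finset.range L).image (fun n : ℕ => a + (n : ℤ)), |h n| := by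
    rw [Finset.sum_image]
    intro x _ y _ hxy
    simpa using hxy
  rw [this, ← Finset.sum_filter_add_sum_filter_not _ (· ∈ F)]
  have h0 : ∑ n ∈ ((Finset.range L).image (fun n : ℕ => a + (n : ℤ))).filter (fun n => n ∉ F),
      |h n| = 0 := by
    refine Finset.sum_eq_zero fun n hn => ?_
    rw [hF n (Finset.mem_filter.1 hn).2, abs_zero]
  rw [h0, add_zero]
  refine Finset.sum_le_sum_of_subset_of_nonneg ?_ fun _ _ _ => abs_nonneg _
  intro n hn
  exact (Finset.mem_filter.1 hn).2

/-- The additive constant in `UniformMean` absorbs any finite change, so the seam of the two-sided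
word at the origin does no harm. -/
theorem UniformMean.congr_off_finset {f g : ℤ → ℝ} {e : ℝ} (hf : UniformMean f e) (F : Finset ℤ)
    (hfg : ∀ n ∉ F, g n = f n) : UniformMean g e := by
  intro ε hε
  obtain ⟨C, hC⟩ := hf ε hε
  refine ⟨C + ∑ n ∈ F, |g n - f n|, fun a L => ?_⟩
  have h1 := sum_abs_window_le (fun n => g n - f n) F (fun n hn => by simp [hfg n hn]) a L
  have h2 := hC a L
  rw [Finset.sum_sub_distrib] at h1
  have h1 := abs_le.1 h1
  have h2 := abs_le.1 h2
  rw [abs_le]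
  constructor <;> linarith [h1.1, h1.2, h2.1, h2.2]

theorem sum_range_two_mul (f : ℤ → ℝ) (b : ℤ) (l : ℕ) :
    ∑ n ∈ Finset.range (2 * l), f (2 * b + n) =
      ∑ k ∈ Finset.range l, (f (2 * (b + k)) + f (2 * (b + k) + 1)) := by
  induction l with
  | zero => simp
  | succ l ih =>
    rw [Finset.sum_range_succ, ← ih, show 2 * (l + 1) = 2 * l + 1 + 1 by ring,
      Finset.sum_range_succ, Finset.sum_range_succ]
    push_cast
    rw [show 2 * b + 2 * (l : ℤ) = 2 * (b + l) by ring,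
      show 2 * b + (2 * (l : ℤ) + 1) = 2 * (b + l) + 1 by ring]
    ring

/-- Aligning a window with the pairs costs at most one dropped term if `L` is odd, and one term
gained and one lost if `a` is odd: `3 * B` in all. -/
theorem abs_window_sub_paired_le {f : ℤ → ℝ} {B : ℝ} (hB : ∀ n, |f n| ≤ B) (a : ℤ) (L : ℕ) :
    |∑ n ∈ Finset.range L, f (a + n) -
      ∑ k ∈ Finset.range (L / 2), (f (2 * (a / 2 + k)) + f (2 * (a / 2 + k) + 1))| ≤ 3 * B := by
  have hB0 : 0 ≤ B := (abs_nonneg _).trans (hB 0)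
  rw [← sum_range_two_mul]
  have h1 : |∑ n ∈ Finset.range L, f (a + n) - ∑ n ∈ Finset.range (2 * (L / 2)), f (a + n)|
      ≤ B := by
    rcases Nat.mod_two_eq_zero_or_one L with h | h
    · rw [show 2 * (L / 2) = L by omega]
      simpa using hB0
    · conv_lhs => rw [show L = 2 * (L / 2) + 1 by omega, Finset.sum_range_succ]
      rw [show (2 * (L / 2) + 1) / 2 = L / 2 by omega]
      simpa using hB _
  have h2 : |∑ n ∈ Finset.range (2 * (L / 2)), f (a + n) -
      ∑ n ∈ Finset.range (2 * (L / 2)), f (2 * (a / 2) + n)| ≤ 2 * B := by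
    rcases Int.emod_two_eq_zero_or_one a with h | h
    · rw [show 2 * (a / 2) = a by omega]
      simpa using hB0
    · set b := 2 * (a / 2) with hb
      have ha : a = b + 1 := by omega
      have h3 := Finset.sum_range_succ (fun n : ℕ => f (b + n)) (2 * (L / 2))
      have h4 := Finset.sum_range_succ' (fun n : ℕ => f (b + n)) (2 * (L / 2))
      have h5 : ∑ n ∈ Finset.range (2 * (L / 2)), f (a + n) =
          ∑ n ∈ Finset.range (2 * (L / 2)), f (b + (n + 1 : ℕ)) := by
        refine Finset.sum_congr rfl fun n _ => ?_
        rw [ha]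
        congr 1
        push_cast
        ring
      have h8 : ∑ n ∈ Finset.range (2 * (L / 2)), f (b + (n + 1 : ℕ)) -
          ∑ n ∈ Finset.range (2 * (L / 2)), f (b + n) =
          f (b + (2 * (L / 2) : ℕ)) - f (b + (0 : ℕ)) := by
        linear_combination h3 - h4
      rw [h5, h8]
      refine (abs_sub _ _).trans ?_
      rw [two_mul B]
      exact add_le_add (hB _) (hB _)
  have h1 := abs_le.1 h1
  have h2 := abs_le.1 h2
  rw [abs_le]
  constructor <;> linarith [h1.1, h1.2, h2.1, h2.2]

theorem UniformMean.of_paired {f : ℤ → ℝ} {B e : ℝ} (hB : ∀ n, |f n| ≤ B)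
    (h : UniformMean (fun k => f (2 * k) + f (2 * k + 1)) e) : UniformMean f (e / 2) := by
  intro ε hε
  obtain ⟨C, hC⟩ := h ε hε
  -- `3 * B` pays for aligning the window, `|e|` for rounding `L / 2` down.
  refine ⟨C + 3 * B + |e|, fun a L => ?_⟩
  have h1 := abs_le.1 (abs_window_sub_paired_le hB a L)
  have h2 := abs_le.1 (hC (a / 2) (L / 2))
  have h3 : ((L / 2 : ℕ) : ℝ) ≤ L / 2 := Nat.cast_div_le
  have h4 : (L : ℝ) / 2 - 1 / 2 ≤ ((L / 2 : ℕ) : ℝ) := by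
    have : L ≤ 2 * (L / 2) + 1 := by omega
    have : (L : ℝ) ≤ 2 * ((L / 2 : ℕ) : ℝ) + 1 := by exact_mod_cast this
    linarith
  have h5 : |((L / 2 : ℕ) : ℝ) * e - L * (e / 2)| ≤ |e| := by
    rw [show ((L / 2 : ℕ) : ℝ) * e - L * (e / 2) = (((L / 2 : ℕ) : ℝ) - L / 2) * e by ring,
      abs_mul]
    refine mul_le_of_le_one_left (abs_nonneg _) ?_
    rw [abs_le]
    constructor <;> linarith
  have h5 := abs_le.1 h5
  have h6 : ε * ((L / 2 : ℕ) : ℝ) ≤ ε * L := by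
    refine mul_le_mul_of_nonneg_left ?_ hε.le
    have : (0 : ℝ) ≤ L := Nat.cast_nonneg _
    linarith
  rw [abs_le]
  constructor <;> linarith [h1.1, h1.2, h2.1, h2.2, h5.1, h5.2]

/-- A window sum over length `L` is, up to sign and a bounded error, one over length `L / 2`. Each
halving therefore adds only a constant, and the sum grows at most logarithmically. This settles the
one distance, 1, whose recursion refers to itself. -/
theorem UniformMean.of_paired_eq_neg {h : ℤ → ℝ} {B : ℝ} (hB : ∀ n, |h n| ≤ B) (F : Finset ℤ)
    (hF : ∀ k ∉ F, h (2 * k) + h (2 * k + 1) = -h k) : UniformMean h 0 := by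
  have hB0 : 0 ≤ B := (abs_nonneg _).trans (hB 0)
  set D := ∑ k ∈ F, |h (2 * k) + h (2 * k + 1) + h k| with hD
  have hD0 : 0 ≤ D := Finset.sum_nonneg fun _ _ => abs_nonneg _
  have key (a : ℤ) (L : ℕ) : |∑ n ∈ Finset.range L, h (a + n)| ≤
      |∑ n ∈ Finset.range (L / 2), h (a / 2 + n)| + (3 * B + D) := by
    have h1 := abs_le.1 (abs_window_sub_paired_le hB a L)
    have h2 := sum_abs_window_le (fun k => h (2 * k) + h (2 * k + 1) + h k) F
      (fun k hk => by rw [hF k hk]; ring) (a / 2) (L / 2)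
    rw [Finset.sum_add_distrib] at h2
    have h2 := abs_le.1 h2
    have h3 := abs_le.1 (le_refl |∑ n ∈ Finset.range (L / 2), h (a / 2 + n)|)
    rw [abs_le]
    constructor <;> linarith [h1.1, h1.2, h2.1, h2.2, h3.1, h3.2]
  intro ε hε
  set K := 3 * B + D with hK
  have hK0 : 0 ≤ K := by positivity
  have triv (a : ℤ) (L : ℕ) : |∑ n ∈ Finset.range L, h (a + n)| ≤ L * B := by
    refine (Finset.abs_sum_le_sum_abs _ _).trans ?_
    refine (Finset.sum_le_sum fun n _ => hB _).trans ?_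
    simp
  -- Windows with `L ≤ 2 * K / ε` are bounded trivially; beyond that length the error `K` of one
  -- halving is at most `ε * L / 2`, which the induction can afford.
  refine ⟨2 * K / ε * B, fun a L => ?_⟩
  rw [mul_zero, sub_zero]
  induction L using Nat.strong_induction_on generalizing a with
  | _ L ih =>
    by_cases hL : (L : ℝ) ≤ 2 * K / ε
    · calc _ ≤ L * B := triv a L
        _ ≤ 2 * K / ε * B := by gcongr
        _ ≤ _ := by linarith [show 0 ≤ ε * L by positivity]
    · push Not at hL
      have hL0 : 0 < L := by
        have : (0 : ℝ) < L := lt_of_le_of_lt (by positivity) hL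
        exact_mod_cast this
      have h1 := ih (L / 2) (by omega) (a / 2)
      have h3 : ((L / 2 : ℕ) : ℝ) ≤ L / 2 := Nat.cast_div_le
      have h4 : 2 * K ≤ ε * L := by
        rw [div_lt_iff₀ hε] at hL
        linarith
      have h5 : ε * ((L / 2 : ℕ) : ℝ) ≤ ε * (L / 2) := mul_le_mul_of_nonneg_left h3 hε.le
      linarith [key a L]

/-! ## The correlations of the Thue–Morse word -/

theorem oneSided_two_mul (n : ℕ) : oneSided (2 * n) = oneSided n := by
  conv_lhs => rw [← isFixedPt_oneSided]
  simp [substWord, substLetter]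

theorem oneSided_two_mul_add_one (n : ℕ) : oneSided (2 * n + 1) = -oneSided n := by
  conv_lhs => rw [← isFixedPt_oneSided]
  have h1 : (2 * n + 1) / 2 = n := by omega
  have h2 : (2 * n + 1) % 2 = 1 := by omega
  simp [substWord, substLetter, h1, h2]

/-- `1` on the nonnegative and `-1` on the negative integers. -/
def sideSign (k : ℤ) : ℝ := if 0 ≤ k then 1 else -1

theorem weight_mul_self (x : ℤ → ℤˣ) (n : ℤ) : weight x n * weight x n = 1 := by
  rcases Int.units_eq_one_or (x n) with h | h <;> simp [weight, h]

theorem abs_weight (x : ℤ → ℤˣ) (n : ℤ) : |weight x n| = 1 := by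
  rcases Int.units_eq_one_or (x n) with h | h <;> simp [weight, h]

theorem abs_weight_mul (x : ℤ → ℤˣ) (m n : ℤ) : |weight x m * weight x n| = 1 := by
  rw [abs_mul, abs_weight, abs_weight, one_mul]

/-- Reflection exchanges even and odd positions, so on the negative side the substitution acts with
the opposite sign; `sideSign` records this. -/
theorem weight_twoSided_two_mul (k : ℤ) :
    weight twoSided (2 * k) = sideSign k * weight twoSided k := by
  by_cases hk : 0 ≤ k
  · have h1 : (2 * k).toNat = 2 * k.toNat := by omega
    simp [weight, twoSided, sideSign, hk, h1, oneSided_two_mul]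
  · have h1 : (-(2 * k) - 1).toNat = 2 * (-k - 1).toNat + 1 := by omega
    simp [weight, twoSided, sideSign, hk, h1, oneSided_two_mul_add_one]

theorem weight_twoSided_two_mul_add_one (k : ℤ) :
    weight twoSided (2 * k + 1) = -(sideSign k * weight twoSided k) := by
  by_cases hk : 0 ≤ k
  · have h1 : (2 * k + 1).toNat = 2 * k.toNat + 1 := by omega
    have h2 : 0 ≤ 2 * k + 1 := by omega
    simp [weight, twoSided, sideSign, hk, h1, h2, oneSided_two_mul_add_one]
  · have h1 : (-(2 * k + 1) - 1).toNat = 2 * (-k - 1).toNat := by omega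
    have h2 : ¬ 0 ≤ 2 * k + 1 := by omega
    simp only [weight, twoSided, sideSign, hk, h1, h2, oneSided_two_mul]
    simp

/-- The signs cancel in a product of two weights unless the two sites lie on different sides of the
origin, which happens only for `k` within `|j|` of it. -/
theorem sideSign_mul_eq_one {k j : ℤ} (hk : k ∉ Finset.Icc (-|j|) |j|) :
    sideSign k * sideSign (k - j) = 1 := by
  rw [Finset.mem_Icc] at hk
  have h1 := neg_abs_le j
  have h2 := le_abs_self j
  by_cases h : 0 ≤ k
  · have : 0 ≤ k - j := by omega
    simp only [sideSign, if_pos h, if_pos this, mul_one]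
  · have : ¬ 0 ≤ k - j := by omega
    simp only [sideSign, if_neg h, if_neg this]
    norm_num

/-- The product of the weights of `x` at distance `m`. -/
def correlation (x : ℤ → ℤˣ) (m n : ℤ) : ℝ := weight x n * weight x (n - m)

theorem abs_correlation (x : ℤ → ℤˣ) (m n : ℤ) : |correlation x m n| ≤ 1 :=
  (abs_weight_mul x n (n - m)).le

theorem correlation_even_paired (j k : ℤ) (hk : k ∉ Finset.Icc (-|j|) |j|) :
    correlation twoSided (2 * j) (2 * k) + correlation twoSided (2 * j) (2 * k + 1) =
      correlation twoSided j k + correlation twoSided j k := by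
  have h := sideSign_mul_eq_one hk
  simp only [correlation]
  rw [show 2 * k - 2 * j = 2 * (k - j) by ring, show 2 * k + 1 - 2 * j = 2 * (k - j) + 1 by ring]
  simp only [weight_twoSided_two_mul, weight_twoSided_two_mul_add_one]
  linear_combination 2 * (weight twoSided k * weight twoSided (k - j)) * h

theorem correlation_odd_paired (j k : ℤ) (hk : k ∉ Finset.Icc (-|j|) |j| ∪
      Finset.Icc (-|j + 1|) |j + 1|) :
    correlation twoSided (2 * j + 1) (2 * k) + correlation twoSided (2 * j + 1) (2 * k + 1) =
      -correlation twoSided j k + -correlation twoSided (j + 1) k := by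
  rw [Finset.notMem_union] at hk
  have h := sideSign_mul_eq_one hk.1
  have h' := sideSign_mul_eq_one hk.2
  simp only [correlation]
  rw [show 2 * k - (2 * j + 1) = 2 * (k - (j + 1)) + 1 by ring,
    show 2 * k + 1 - (2 * j + 1) = 2 * (k - j) by ring]
  simp only [weight_twoSided_two_mul, weight_twoSided_two_mul_add_one]
  linear_combination -(weight twoSided k * weight twoSided (k - j)) * h -
    (weight twoSided k * weight twoSided (k - (j + 1))) * h'

theorem UniformMean.correlation_neg {x : ℤ → ℤˣ} {m : ℤ} {e : ℝ}
    (h : UniformMean (correlation x m) e) : UniformMean (correlation x (-m)) e := by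
  convert h.comp_add m using 2 with n
  simp only [correlation]
  rw [show n + m - m = n by ring, show n - -m = n + m by ring, mul_comm]

theorem uniformMean_correlation_zero (x : ℤ → ℤˣ) : UniformMean (correlation x 0) 1 := by
  convert UniformMean.const 1 using 2 with n
  simp [correlation, weight_mul_self]

theorem uniformMean_correlation_two_mul {j : ℤ} {e : ℝ}
    (h : UniformMean (correlation twoSided j) e) :
    UniformMean (correlation twoSided (2 * j)) e := by
  have := UniformMean.of_paired (abs_correlation twoSided (2 * j))
    ((h.add h).congr_off_finset _ fun k hk => correlation_even_paired j k hk)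
  convert this using 1
  ring

theorem uniformMean_correlation_two_mul_add_one {j : ℤ} {d e : ℝ}
    (h : UniformMean (correlation twoSided j) d)
    (h' : UniformMean (correlation twoSided (j + 1)) e) :
    UniformMean (correlation twoSided (2 * j + 1)) (-(d + e) / 2) := by
  have := UniformMean.of_paired (abs_correlation twoSided (2 * j + 1))
    ((h.neg.add h'.neg).congr_off_finset _ fun k hk => correlation_odd_paired j k hk)
  convert this using 1
  ring

theorem uniformMean_correlation_one : UniformMean (correlation twoSided 1) (-1 / 3) := by
  -- Distance 1 has `j = 0`, so its pair sum is -1 minus the correlation at distance 1 itself.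
  -- Adding 1/3, from the fixed point of e = -(1 + e)/2, makes the relation homogeneous.
  have h1 : UniformMean (fun n => correlation twoSided 1 n + 1 / 3) 0 := by
    refine UniformMean.of_paired_eq_neg (B := 2) (fun n => ?_)
      (Finset.Icc (-|0|) |0| ∪ Finset.Icc (-|0 + 1|) |0 + 1|) fun k hk => ?_
    · have := abs_le.1 (abs_correlation twoSided 1 n)
      rw [abs_le]
      constructor <;> linarith [this.1, this.2]
    · have := correlation_odd_paired 0 k hk
      have h0 : correlation twoSided 0 k = 1 := by simp [correlation, weight_mul_self]
      simp only [mul_zero, zero_add] at this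
      linarith
  convert h1.add (UniformMean.const (-1 / 3)) using 1
  · funext n; ring
  · ring

theorem exists_uniformMean_correlation (m : ℤ) :
    ∃ e, UniformMean (correlation twoSided m) e := by
  suffices h : ∀ n : ℕ, ∃ e, UniformMean (correlation twoSided n) e by
    obtain ⟨e, he⟩ := h m.natAbs
    rcases Int.natAbs_eq m with hm | hm
    · exact ⟨e, by rwa [hm]⟩
    · exact ⟨e, by rw [hm]; exact he.correlation_neg⟩
  intro n
  induction n using Nat.strong_induction_on with
  | _ n ih =>
    rcases Nat.lt_or_ge n 2 with hn | hn
    · interval_cases n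
      · exact ⟨1, uniformMean_correlation_zero _⟩
      · exact ⟨_, uniformMean_correlation_one⟩
    · obtain ⟨d, hd⟩ := ih (n / 2) (by omega)
      rcases Nat.mod_two_eq_zero_or_one n with h | h
      · refine ⟨d, ?_⟩
        have := uniformMean_correlation_two_mul hd
        rwa [show 2 * ((n / 2 : ℕ) : ℤ) = n by omega] at this
      -- Here `n` is odd and at least 3, so `n / 2 + 1 < n`; this fails at `n = 1`, which is why 1
      -- is a base case.
      · obtain ⟨e, he⟩ := ih (n / 2 + 1) (by omega)
        push_cast at he
        have := uniformMean_correlation_two_mul_add_one hd he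
        exact ⟨_, by rwa [show 2 * ((n / 2 : ℕ) : ℤ) + 1 = n by omega] at this⟩

/-! ## Passage to the hull -/

theorem twoSided_mem_hull : twoSided ∈ hull := by
  refine subset_closure ⟨0, ?_⟩
  funext n
  simp [shift]

theorem exists_shift_eq_of_mem_hull {x : ℤ → ℤˣ} (hx : x ∈ hull) (F : Finset ℤ) :
    ∃ t : ℤ, ∀ n ∈ F, x n = twoSided (n + t) := by
  have hopen : IsOpen {y : ℤ → ℤˣ | ∀ n ∈ F, y n = x n} := by
    have : {y : ℤ → ℤˣ | ∀ n ∈ F, y n = x n} = Set.pi (F : Set ℤ) fun n => {x n} := by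
      ext y; simp [Set.mem_pi]
    rw [this]
    exact isOpen_set_pi F.finite_toSet fun n _ => isOpen_discrete _
  obtain ⟨y, hy, t, rfl⟩ := mem_closure_iff.1 hx _ hopen fun n _ => rfl
  exact ⟨t, fun n hn => (hy n hn).symm⟩

/-- On each finite window `x` agrees with a shift of the Thue–Morse word. The shift depends on the
window, but the bound does not depend on the position, so the same `C` serves. -/
theorem UniformMean.correlation_of_mem_hull {x : ℤ → ℤˣ} (hx : x ∈ hull) {m : ℤ} {e : ℝ}
    (h : UniformMean (correlation twoSided m) e) : UniformMean (correlation x m) e := by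
  intro ε hε
  obtain ⟨C, hC⟩ := h ε hε
  refine ⟨C, fun a L => ?_⟩
  obtain ⟨t, ht⟩ := exists_shift_eq_of_mem_hull hx
    ((Finset.range L).image (fun n : ℕ => a + (n : ℤ)) ∪
      (Finset.range L).image (fun n : ℕ => a + (n : ℤ) - m))
  convert hC (a + t) L using 3
  refine Finset.sum_congr rfl fun n hn => ?_
  have h1 := ht (a + n) (Finset.mem_union_left _ (Finset.mem_image_of_mem _ hn))
  have h2 := ht (a + n - m) (Finset.mem_union_right _
    (Finset.mem_image_of_mem (fun n : ℕ => a + (n : ℤ) - m) hn))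
  simp only [correlation, weight]
  rw [h1, h2, show a + n - m + t = a + t + n - m by ring, show a + n + t = a + t + n by ring]

theorem sum_Icc_neg_eq_sum_range (f : ℤ → ℝ) (N : ℕ) :
    ∑ n ∈ Finset.Icc (-(N : ℤ)) N, f n = ∑ n ∈ Finset.range (2 * N + 1), f (-N + n) := by
  symm
  refine Finset.sum_bij (fun n _ => -(N : ℤ) + n) ?_ ?_ ?_ fun _ _ => rfl
  · intro n hn
    rw [Finset.mem_range] at hn
    rw [Finset.mem_Icc]
    omega
  · intro a _ b _ h
    simpa using h
  · intro b hb
    rw [Finset.mem_Icc] at hb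
    exact ⟨(b + N).toNat, by rw [Finset.mem_range]; omega, by omega⟩

theorem tendsto_inv_two_mul_add_one : Tendsto (fun N : ℕ => (2 * N + 1 : ℝ)⁻¹) atTop (𝓝 0) := by
  refine tendsto_inv_atTop_zero.comp (tendsto_atTop_add_const_right _ _ ?_)
  exact tendsto_natCast_atTop_atTop.const_mul_atTop two_pos

theorem UniformMean.tendsto_siteAverage {x : ℤ → ℤˣ} {m : ℤ} {e : ℝ}
    (h : UniformMean (correlation x m) e) :
    Tendsto (siteAverage (weight x) m) atTop (𝓝 e) := by
  rw [Metric.tendsto_atTop']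
  intro ε hε
  obtain ⟨C, hC⟩ := h (ε / 2) (by positivity)
  have h0 := (tendsto_inv_two_mul_add_one.const_mul C)
  rw [mul_zero] at h0
  obtain ⟨N₀, hN₀⟩ := eventually_atTop.1 (h0.eventually_lt_const (half_pos hε))
  refine ⟨N₀, fun N hN => ?_⟩
  have h1 := hC (-N) (2 * N + 1)
  have h2 := hN₀ N hN.le
  have hp : (0 : ℝ) < 2 * N + 1 := by positivity
  rw [Real.dist_eq, siteAverage, sum_Icc_neg_eq_sum_range (fun n => weight x n * weight x (n - m))]
  push_cast at h1
  rw [← div_eq_mul_inv, div_lt_iff₀ hp] at h2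
  have h3 : ∀ S : ℝ, (2 * N + 1 : ℝ)⁻¹ * S - e = (S - (2 * N + 1) * e) / (2 * N + 1) := by
    intro S; field_simp
  rw [h3, abs_div, abs_of_pos hp, div_lt_iff₀ hp]
  refine h1.trans_lt ?_
  linarith

theorem pairSum_eq (c : ℤ → ℝ) (m : ℤ) (N : ℕ) :
    ∑ p ∈ (Finset.Icc (-(N : ℤ)) N ×ˢ Finset.Icc (-(N : ℤ)) N) with p.1 - p.2 = m, c p.1 * c p.2 =
      ∑ n ∈ Finset.Icc (-(N : ℤ)) N with n - m ∈ Finset.Icc (-(N : ℤ)) N, c n * c (n - m) := by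
  refine Finset.sum_bij (fun p _ => p.1) ?_ ?_ ?_ ?_
  · rintro ⟨k, l⟩ h
    simp only [Finset.mem_filter, Finset.mem_product, Finset.mem_Icc] at h ⊢
    omega
  · rintro ⟨k, l⟩ h ⟨k', l'⟩ h' hk
    simp only [Finset.mem_filter] at h h' hk
    ext <;> simp only <;> omega
  · intro n hn
    simp only [Finset.mem_filter] at hn
    exact ⟨(n, n - m), by simp only [Finset.mem_filter, Finset.mem_product]; exact
      ⟨hn, by omega⟩, rfl⟩
  · rintro ⟨k, l⟩ h
    simp only [Finset.mem_filter] at h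
    rw [← h.2]
    congr 2
    ring

/-- The two sums differ only in sites `n` of the window whose partner `n - m` leaves it; these lie
within `|m|` of an end. -/
theorem abs_siteAverage_sub_pairAverage_le (x : ℤ → ℤˣ) (m : ℤ) (N : ℕ) :
    |siteAverage (weight x) m N - pairAverage (weight x) m N| ≤
      (2 * |(m : ℝ)|) * (2 * N + 1 : ℝ)⁻¹ := by
  rw [siteAverage, pairAverage, pairSum_eq, ← mul_sub, abs_mul,
    abs_of_pos (by positivity : (0 : ℝ) < (2 * N + 1 : ℝ)⁻¹), mul_comm]
  refine mul_le_mul_of_nonneg_right ?_ (by positivity)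
  rw [← Finset.sum_filter_add_sum_filter_not (Finset.Icc (-(N : ℤ)) N)
    (fun n => n - m ∈ Finset.Icc (-(N : ℤ)) N), add_sub_cancel_left]
  refine (Finset.abs_sum_le_sum_abs _ _).trans ?_
  simp only [abs_weight_mul, Finset.sum_const, nsmul_eq_mul, mul_one]
  have hsub : (Finset.Icc (-(N : ℤ)) N).filter (fun n => n - m ∉ Finset.Icc (-(N : ℤ)) N) ⊆
      Finset.Ico (-(N : ℤ)) (-N + m.natAbs) ∪ Finset.Ioc ((N : ℤ) - m.natAbs) N := by
    intro n hn
    simp only [Finset.mem_filter, Finset.mem_Icc, Finset.mem_union, Finset.mem_Ico,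
      Finset.mem_Ioc] at hn ⊢
    omega
  have hcard := (Finset.card_le_card hsub).trans (Finset.card_union_le _ _)
  simp only [Int.card_Ico, Int.card_Ioc] at hcard
  rw [show (-(N : ℤ) + m.natAbs - -N).toNat = m.natAbs by omega,
    show ((N : ℤ) - (N - m.natAbs)).toNat = m.natAbs by omega, ← two_mul] at hcard
  have : ((m.natAbs : ℕ) : ℝ) = |(m : ℝ)| := by
    rw [Nat.cast_natAbs, Int.cast_abs]
  rw [← this]
  exact_mod_cast hcard

theorem UniformMean.tendsto_pairAverage {x : ℤ → ℤˣ} {m : ℤ} {e : ℝ}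
    (h : UniformMean (correlation x m) e) :
    Tendsto (pairAverage (weight x) m) atTop (𝓝 e) := by
  have h0 := tendsto_inv_two_mul_add_one.const_mul (2 * |(m : ℝ)|)
  rw [mul_zero] at h0
  have h1 := squeeze_zero_norm
    (f := fun N => siteAverage (weight x) m N - pairAverage (weight x) m N)
    (fun N => abs_siteAverage_sub_pairAverage_le x m N) h0
  simpa using h.tendsto_siteAverage.sub h1

theorem eta_eq_of_uniformMean {m : ℤ} {e : ℝ} (h : UniformMean (correlation twoSided m) e) :
    eta m = e :=
  h.tendsto_pairAverage.limUnder_eq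

theorem uniformMean_correlation {x : ℤ → ℤˣ} (hx : x ∈ hull) (m : ℤ) :
    UniformMean (correlation x m) (eta m) := by
  obtain ⟨e, he⟩ := exists_uniformMean_correlation m
  rw [eta_eq_of_uniformMean he]
  exact he.correlation_of_mem_hull hx

theorem tendsto_pairAverage {x : ℤ → ℤˣ} (hx : x ∈ hull) (m : ℤ) :
    Tendsto (pairAverage (weight x) m) atTop (𝓝 (eta m)) :=
  (uniformMean_correlation hx m).tendsto_pairAverage

theorem tendsto_siteAverage {x : ℤ → ℤˣ} (hx : x ∈ hull) (m : ℤ) :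
    Tendsto (siteAverage (weight x) m) atTop (𝓝 (eta m)) :=
  (uniformMean_correlation hx m).tendsto_siteAverage

/-! ## The recursion for the autocorrelation coefficients -/

theorem eta_zero : eta 0 = 1 := eta_eq_of_uniformMean (uniformMean_correlation_zero _)

theorem eta_one : eta 1 = -1 / 3 := eta_eq_of_uniformMean uniformMean_correlation_one

theorem eta_neg (m : ℤ) : eta (-m) = eta m :=
  eta_eq_of_uniformMean (uniformMean_correlation twoSided_mem_hull m).correlation_neg

theorem eta_two_mul (m : ℤ) : eta (2 * m) = eta m :=
  eta_eq_of_uniformMean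
    (uniformMean_correlation_two_mul (uniformMean_correlation twoSided_mem_hull m))

theorem eta_two_mul_add_one (m : ℤ) : eta (2 * m + 1) = -(eta m + eta (m + 1)) / 2 :=
  eta_eq_of_uniformMean
    (uniformMean_correlation_two_mul_add_one (uniformMean_correlation twoSided_mem_hull m)
      (uniformMean_correlation twoSided_mem_hull (m + 1)))

theorem abs_siteAverage_le (x : ℤ → ℤˣ) (m : ℤ) (N : ℕ) :
    |siteAverage (weight x) m N| ≤ 1 := by
  have hp : (0 : ℝ) < 2 * N + 1 := by positivity
  rw [siteAverage, abs_mul, abs_of_pos (inv_pos.2 hp), inv_mul_le_iff₀ hp, mul_one]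
  refine (Finset.abs_sum_le_sum_abs _ _).trans ?_
  simp only [abs_weight_mul, Finset.sum_const, nsmul_eq_mul, mul_one, Int.card_Icc]
  have : ((N : ℤ) + 1 - -N).toNat = 2 * N + 1 := by omega
  rw [this]
  push_cast
  exact le_rfl

theorem abs_eta_le_one (m : ℤ) : |eta m| ≤ 1 :=
  le_of_tendsto (tendsto_siteAverage twoSided_mem_hull m).abs
    (Eventually.of_forall fun N => abs_siteAverage_le _ m N)

/-! ## The autocorrelation measure -/

theorem combIntegral_truncate (c : ℤ → ℝ) (N : ℕ) (f : ℝ → ℂ) :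
    combIntegral (truncate c N) f = ∑ n ∈ Finset.Icc (-(N : ℤ)) N, (c n : ℂ) * f n := by
  rw [combIntegral, tsum_eq_sum (s := Finset.Icc (-(N : ℤ)) N)]
  · refine Finset.sum_congr rfl fun n hn => ?_
    rw [truncate, if_pos (abs_le.2 (Finset.mem_Icc.1 hn))]
  · intro n hn
    rw [truncate, if_neg (fun h => hn (Finset.mem_Icc.2 (abs_le.1 h)))]
    simp

/-- Group the pairs of sites by their difference; differences outside `T` contribute nothing because
`f` vanishes there. -/
theorem averagedConvolution_eq_sum (c : ℤ → ℝ) (N : ℕ) (f : ℝ → ℂ) (T : Finset ℤ)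
    (hT : ∀ m : ℤ, m ∉ T → f m = 0) :
    averagedConvolution c N f = ∑ m ∈ T, (pairAverage c m N : ℂ) * f m := by
  simp only [averagedConvolution, combIntegral_truncate, pairAverage, Complex.ofReal_mul,
    mul_assoc, ← Finset.mul_sum]
  congr 1
  · push_cast; rfl
  · simp only [Finset.mul_sum, Complex.ofReal_sum, Finset.sum_mul, Finset.sum_filter]
    rw [Finset.sum_comm' (t' := Finset.Icc (-(N : ℤ)) N ×ˢ Finset.Icc (-(N : ℤ)) N)
      (s' := fun _ => T) (by intros; tauto), ← Finset.sum_product']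
    refine Finset.sum_congr rfl fun p _ => ?_
    have hite (m : ℤ) : ((if p.1 - p.2 = m then c p.1 * c p.2 else 0 : ℝ) : ℂ) * f m =
        if p.1 - p.2 = m then (c p.1 : ℂ) * c p.2 * f m else 0 := by
      split_ifs <;> simp
    simp only [hite, Finset.sum_ite_eq]
    split_ifs with h
    · push_cast; ring
    · have := hT _ h
      push_cast at this
      rw [this]; ring

theorem isAutocorrelation_of_tendsto_pairAverage {c e : ℤ → ℝ}
    (h : ∀ m, Tendsto (pairAverage c m) atTop (𝓝 (e m))) : IsAutocorrelation c e := by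
  intro f _ hf
  obtain ⟨R, hR⟩ := hf.isCompact.isBounded.exists_norm_le
  have hT : ∀ m : ℤ, m ∉ Finset.Icc (-⌈R⌉) ⌈R⌉ → f m = 0 := by
    intro m hm
    by_contra hne
    refine hm ?_
    have h1 := hR m (subset_tsupport f hne)
    rw [Real.norm_eq_abs] at h1
    rw [Finset.mem_Icc, ← abs_le]
    have : ((|m| : ℤ) : ℝ) ≤ (⌈R⌉ : ℤ) := by
      push_cast
      exact h1.trans (Int.le_ceil R)
    exact_mod_cast this
  have h2 : combIntegral e f = ∑ m ∈ Finset.Icc (-⌈R⌉) ⌈R⌉, (e m : ℂ) * f m :=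
    tsum_eq_sum fun m hm => by rw [hT m hm, mul_zero]
  simp only [averagedConvolution_eq_sum c _ f _ hT, h2]
  exact tendsto_finsetSum _ fun m _ =>
    ((Complex.continuous_ofReal.tendsto _).comp (h m)).mul_const _

/-! ## Measures on the circle with prescribed Fourier coefficients -/

theorem integral_fourier (n : ℤ) :
    ∫ y : UnitAddCircle, fourier n y = if n = 0 then 1 else 0 := by
  split_ifs with h
  · subst h
    simp [measureReal_def]
  · exact integral_eq_zero_of_add_right_eq_neg (fourier_add_half_inv_index h one_pos)

/-- The trigonometric polynomial `∑ w n * exp (-2πi n y)`, summed over `|n| ≤ N`. -/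
def windowPolynomial (w : ℤ → ℝ) (N : ℕ) (y : UnitAddCircle) : ℂ :=
  ∑ n ∈ Finset.Icc (-(N : ℤ)) N, (w n : ℂ) * fourier (-n) y

theorem continuous_windowPolynomial (w : ℤ → ℝ) (N : ℕ) :
    Continuous (windowPolynomial w N) := by
  unfold windowPolynomial
  fun_prop

/-- The normalised intensity of the word `w` in the window `|n| ≤ N`. -/
def windowIntensity (w : ℤ → ℝ) (N : ℕ) (y : UnitAddCircle) : ℝ :=
  (2 * N + 1 : ℝ)⁻¹ * ‖windowPolynomial w N y‖ ^ 2

theorem continuous_windowIntensity (w : ℤ → ℝ) (N : ℕ) :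
    Continuous (windowIntensity w N) := by
  have := continuous_windowPolynomial w N
  unfold windowIntensity
  fun_prop

theorem windowIntensity_nonneg (w : ℤ → ℝ) (N : ℕ) (y : UnitAddCircle) :
    0 ≤ windowIntensity w N y := by
  unfold windowIntensity
  positivity

theorem windowIntensity_mul_fourier (w : ℤ → ℝ) (N : ℕ) (m : ℤ) (y : UnitAddCircle) :
    (windowIntensity w N y : ℂ) * fourier m y = ((2 * N + 1 : ℝ)⁻¹ : ℂ) *
      ∑ p ∈ Finset.Icc (-(N : ℤ)) N ×ˢ Finset.Icc (-(N : ℤ)) N,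
        ((w p.1 * w p.2 : ℝ) : ℂ) * fourier (m - (p.1 - p.2)) y := by
  have h : ((‖windowPolynomial w N y‖ : ℂ)) ^ 2 =
      windowPolynomial w N y * (starRingEnd ℂ) (windowPolynomial w N y) :=
    (Complex.mul_conj' _).symm
  rw [windowIntensity, Complex.ofReal_mul, Complex.ofReal_pow, h, mul_assoc]
  congr 1
  · push_cast; rfl
  · rw [windowPolynomial, map_sum, Finset.sum_mul_sum, ← Finset.sum_product', Finset.sum_mul]
    refine Finset.sum_congr rfl fun p _ => ?_
    rw [map_mul, Complex.conj_ofReal, ← fourier_neg, neg_neg, Complex.ofReal_mul,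
      show m - (p.1 - p.2) = -p.1 + p.2 + m by ring, fourier_add, fourier_add]
    ring

theorem integral_windowIntensity_mul_fourier (w : ℤ → ℝ) (N : ℕ) (m : ℤ) :
    ∫ y, (windowIntensity w N y : ℂ) * fourier m y = (pairAverage w m N : ℂ) := by
  simp only [windowIntensity_mul_fourier]
  rw [integral_const_mul, integral_finsetSum]
  · rw [pairAverage, Complex.ofReal_mul, Complex.ofReal_sum, Finset.sum_filter]
    congr 1
    · push_cast; rfl
    · refine Finset.sum_congr rfl fun p _ => ?_
      rw [integral_const_mul, integral_fourier]
      simp only [sub_eq_zero, @eq_comm _ m]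
      split_ifs <;> simp
  · intro p _
    exact (Continuous.integrable_of_hasCompactSupport (by fun_prop)
      (HasCompactSupport.of_compactSpace _))

/-- The measure on the circle with density `windowIntensity w N`. -/
def windowMeasure (w : ℤ → ℝ) (N : ℕ) : Measure UnitAddCircle :=
  volume.withDensity fun y => ENNReal.ofReal (windowIntensity w N y)

theorem integral_fourier_windowMeasure (w : ℤ → ℝ) (N : ℕ) (m : ℤ) :
    ∫ y, fourier m y ∂(windowMeasure w N) = (pairAverage w m N : ℂ) := by
  rw [windowMeasure, integral_withDensity_eq_integral_toReal_smul
    (continuous_windowIntensity w N).measurable.ennreal_ofReal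
    (Eventually.of_forall fun _ => ENNReal.ofReal_lt_top),
    ← integral_windowIntensity_mul_fourier]
  refine integral_congr_ae (Eventually.of_forall fun y => ?_)
  simp only [ENNReal.toReal_ofReal (windowIntensity_nonneg w N y), Complex.real_smul]

instance (w : ℤ → ℝ) (N : ℕ) : IsFiniteMeasure (windowMeasure w N) := by
  refine isFiniteMeasure_withDensity_ofReal ?_
  exact ((continuous_windowIntensity w N).integrable_of_hasCompactSupport
    (HasCompactSupport.of_compactSpace _)).2

theorem pairAverage_zero (x : ℤ → ℤˣ) (N : ℕ) : pairAverage (weight x) 0 N = 1 := by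
  rw [pairAverage, pairSum_eq]
  have : ((N : ℤ) + 1 - -N).toNat = 2 * N + 1 := by omega
  simp only [sub_zero, Finset.filter_mem_eq_inter, Finset.inter_self, weight_mul_self,
    Finset.sum_const, Int.card_Icc, nsmul_eq_mul, mul_one, this]
  push_cast
  exact inv_mul_cancel₀ (by positivity)

instance (x : ℤ → ℤˣ) (N : ℕ) : IsProbabilityMeasure (windowMeasure (weight x) N) := by
  have h := integral_fourier_windowMeasure (weight x) N 0
  simp only [fourier_zero, integral_const, pairAverage_zero, Complex.real_smul, mul_one,
    Complex.ofReal_inj] at h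
  have h' := ofReal_measureReal (μ := windowMeasure (weight x) N) (s := Set.univ)
  rw [h, ENNReal.ofReal_one] at h'
  exact ⟨h'.symm⟩

/-- Herglotz's theorem in this case: probability measures on a compact space are weakly compact, and
the characters are continuous test functions. -/
theorem exists_circleMeasure : ∃ μ : Measure UnitAddCircle, IsProbabilityMeasure μ ∧
    ∀ m : ℤ, ∫ y, fourier m y ∂μ = (eta m : ℂ) := by
  let P : ℕ → ProbabilityMeasure UnitAddCircle := fun N =>
    ⟨windowMeasure (weight twoSided) N, inferInstance⟩
  -- A limit along an ultrafilter replaces a convergent subsequence.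
  let U : Ultrafilter ℕ := hyperfilter ℕ
  have hP : Tendsto P U (𝓝 (U.map P).lim) := (U.map P).le_nhds_lim
  refine ⟨(U.map P).lim, inferInstance, fun m => ?_⟩
  have h1 := (ProbabilityMeasure.tendsto_iff_forall_integral_rclike_tendsto ℂ).1 hP
    (BoundedContinuousFunction.mkOfCompact (fourier m))
  have h2 : Tendsto (fun N => (pairAverage (weight twoSided) m N : ℂ)) U (𝓝 (eta m)) :=
    ((Complex.continuous_ofReal.tendsto _).comp (tendsto_pairAverage twoSided_mem_hull m)).mono_left
      Nat.hyperfilter_le_atTop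
  refine tendsto_nhds_unique h1 ?_
  convert h2 using 2 with N
  exact integral_fourier_windowMeasure _ _ _

/-- Integration against a finite measure is continuous for the uniform norm, and trigonometric
polynomials are dense. -/
theorem circleMeasure_ext {μ ν : Measure UnitAddCircle} [IsFiniteMeasure μ] [IsFiniteMeasure ν]
    (h : ∀ m : ℤ, ∫ y, fourier m y ∂μ = ∫ y, fourier m y ∂ν) : μ = ν := by
  have hint (ρ : Measure UnitAddCircle) [IsFiniteMeasure ρ] (f : C(UnitAddCircle, ℂ)) :
      Integrable f ρ :=
    f.continuous.integrable_of_hasCompactSupport (HasCompactSupport.of_compactSpace _)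
  let L (ρ : Measure UnitAddCircle) : C(UnitAddCircle, ℂ) → ℂ := fun g => ∫ y, g y ∂ρ
  have hL (ρ : Measure UnitAddCircle) [IsFiniteMeasure ρ] : Continuous (L ρ) := by
    refine (LipschitzWith.of_dist_le_mul (K := (ρ Set.univ).toNNReal) fun f g => ?_).continuous
    simp only [L]
    rw [dist_eq_norm, ← integral_sub (hint ρ f) (hint ρ g), mul_comm]
    exact norm_integral_le_of_norm_le_const
      (Eventually.of_forall fun y => by rw [← dist_eq_norm]; exact ContinuousMap.dist_apply_le_dist y)
  have hclosed : IsClosed {g | L μ g = L ν g} := isClosed_eq (hL μ) (hL ν)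
  have hspan : ((Submodule.span ℂ (Set.range (fourier (T := 1))) :
      Submodule ℂ C(UnitAddCircle, ℂ)) : Set C(UnitAddCircle, ℂ)) ⊆ {g | L μ g = L ν g} := by
    intro g hg
    induction hg using Submodule.span_induction with
    | mem x hx =>
      obtain ⟨m, rfl⟩ := hx
      exact h m
    | zero => simp [L]
    | add f g _ _ hf hg =>
      simp only [Set.mem_ofPred_eq, L, ContinuousMap.add_apply] at hf hg ⊢
      rw [integral_add (hint μ f) (hint μ g), integral_add (hint ν f) (hint ν g), hf, hg]
    | smul c f _ hf =>
      simp only [Set.mem_ofPred_eq, L, ContinuousMap.smul_apply] at hf ⊢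
      rw [integral_smul, integral_smul, hf]
  refine ext_of_forall_integral_eq_of_IsFiniteMeasure fun f => ?_
  let g : C(UnitAddCircle, ℂ) := ⟨fun y => (f y : ℂ), by fun_prop⟩
  have hg : g ∈ (Submodule.span ℂ (Set.range (fourier (T := 1)))).topologicalClosure := by
    rw [span_fourier_closure_eq_top]
    trivial
  have h1 : L μ g = L ν g := closure_minimal hspan hclosed hg
  simp only [L, g, ContinuousMap.coe_mk] at h1
  rw [integral_complex_ofReal, integral_complex_ofReal] at h1
  exact_mod_cast h1

/-! ## Measures on `[0, 1)` with prescribed Fourier coefficients -/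

/-- The representative in `[0, 1)` of a point of the circle. -/
def representative (y : UnitAddCircle) : ℝ := AddCircle.measurableEquivIco 1 0 y

theorem measurable_representative : Measurable representative :=
  measurable_subtype_coe.comp (AddCircle.measurableEquivIco 1 0).measurable

theorem representative_mem (y : UnitAddCircle) : representative y ∈ Set.Ico (0 : ℝ) 1 := by
  obtain ⟨h1, h2⟩ := (AddCircle.measurableEquivIco 1 0 y).2
  exact ⟨h1, h2.trans_eq (zero_add 1)⟩

theorem coe_representative (y : UnitAddCircle) : (representative y : UnitAddCircle) = y :=
  (AddCircle.measurableEquivIco 1 0).symm_apply_apply y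

theorem representative_coe {x : ℝ} (hx : x ∈ Set.Ico (0 : ℝ) 1) :
    representative (x : UnitAddCircle) = x := by
  have hx' : x ∈ Set.Ico (0 : ℝ) (0 + 1) := by rwa [zero_add]
  exact congrArg Subtype.val ((AddCircle.measurableEquivIco 1 0).apply_symm_apply ⟨x, hx'⟩)

theorem exp_eq_fourier (m : ℤ) (x : ℝ) :
    Complex.exp (2 * Real.pi * Complex.I * m * x) = fourier m (x : UnitAddCircle) := by
  rw [fourier_coe_apply]
  simp

theorem measurable_coe_circle : Measurable ((↑) : ℝ → UnitAddCircle) :=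
  AddCircle.measurable_mk'

theorem exists_hasFourierCoefficients_eta : ∃ ν, HasFourierCoefficients ν eta := by
  obtain ⟨μ, hμ, h⟩ := exists_circleMeasure
  refine ⟨μ.map representative, ?_, ?_, fun m => ?_⟩
  · infer_instance
  · rw [Measure.map_apply measurable_representative measurableSet_Ico.compl]
    convert measure_empty (μ := μ)
    ext y
    simpa using representative_mem y
  · rw [integral_map measurable_representative.aemeasurable
      (Continuous.aestronglyMeasurable (by fun_prop)), ← h]
    simp only [exp_eq_fourier, coe_representative]

theorem HasFourierCoefficients.eq {ν ν' : Measure ℝ} {e : ℤ → ℝ}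
    (h : HasFourierCoefficients ν e) (h' : HasFourierCoefficients ν' e) : ν = ν' := by
  have key (ρ : Measure ℝ) (hρ : ρ (Set.Ico (0 : ℝ) 1)ᶜ = 0) :
      (ρ.map ((↑) : ℝ → UnitAddCircle)).map representative = ρ := by
    rw [Measure.map_map measurable_representative measurable_coe_circle]
    conv_rhs => rw [← Measure.map_id (μ := ρ)]
    refine Measure.map_congr ?_
    filter_upwards [mem_ae_iff.2 hρ] with x hx using representative_coe hx
  obtain ⟨h1, h2, h3⟩ := h
  obtain ⟨h1', h2', h3'⟩ := h'
  rw [← key ν h2, ← key ν' h2']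
  congr 1
  refine circleMeasure_ext fun m => ?_
  rw [integral_map measurable_coe_circle.aemeasurable
      (fourier m).continuous.aestronglyMeasurable,
    integral_map measurable_coe_circle.aemeasurable
      (fourier m).continuous.aestronglyMeasurable]
  simp only [← exp_eq_fourier]
  rw [h3, h3']

/-! ## Quasi-orthogonal sequences -/

/-- Passing from `N` to `N + 1` adds the square of the new term and twice its inner products with
the old ones, at most `h 0 + 2 * ∑ h (d + 1)`. -/
theorem integral_norm_sq_sum_le {ρ : Measure ℝ} [IsFiniteMeasure ρ] {X : ℕ → ℝ → ℂ}
    (hX : ∀ k, Continuous (X k)) (hb : ∀ k, ∃ B, ∀ x, ‖X k x‖ ≤ B) {h : ℕ → ℝ}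
    (hcorr : ∀ j k, j ≤ k → ‖∫ x, X k x * (starRingEnd ℂ) (X j x) ∂ρ‖ ≤ h (k - j)) (N : ℕ) :
    ∫ x, ‖∑ k ∈ Finset.range N, X k x‖ ^ 2 ∂ρ ≤ 2 * N * ∑ d ∈ Finset.range N, h d := by
  have hh : ∀ d, 0 ≤ h d := fun d => (norm_nonneg _).trans (by simpa using hcorr 0 d d.zero_le)
  have hint (j k : ℕ) : Integrable (fun x => X k x * (starRingEnd ℂ) (X j x)) ρ := by
    obtain ⟨B, hB⟩ := hb k
    obtain ⟨B', hB'⟩ := hb j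
    refine Integrable.of_bound (C := B * B') (Continuous.aestronglyMeasurable
      ((hX k).mul (Complex.continuous_conj.comp (hX j)))) (Eventually.of_forall fun x => ?_)
    rw [norm_mul, RCLike.norm_conj]
    exact mul_le_mul (hB x) (hB' x) (norm_nonneg _) ((norm_nonneg _).trans (hB x))
  have hsq (N : ℕ) : Integrable (fun x => ‖∑ k ∈ Finset.range N, X k x‖ ^ 2) ρ := by
    choose B hB using hb
    refine Integrable.of_bound (C := (∑ k ∈ Finset.range N, B k) ^ 2)
      (Continuous.aestronglyMeasurable (by fun_prop)) (Eventually.of_forall fun x => ?_)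
    rw [norm_pow, norm_norm]
    exact pow_le_pow_left₀ (norm_nonneg _) (norm_sum_le_of_le _ fun k _ => hB k x) 2
  induction N with
  | zero => simp
  | succ N ih =>
    have h1 (x : ℝ) : ‖∑ k ∈ Finset.range (N + 1), X k x‖ ^ 2 =
        (X N x * (starRingEnd ℂ) (X N x)).re + ‖∑ k ∈ Finset.range N, X k x‖ ^ 2 +
        2 * (∑ k ∈ Finset.range N, X N x * (starRingEnd ℂ) (X k x)).re := by
      rw [Finset.sum_range_succ, add_comm, Complex.sq_norm, Complex.normSq_add, Complex.sq_norm,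
        Complex.mul_conj, Complex.ofReal_re, map_sum (starRingEnd ℂ), Finset.mul_sum]
    have hcross : Integrable
        (fun x => ∑ k ∈ Finset.range N, X N x * (starRingEnd ℂ) (X k x)) ρ :=
      integrable_finsetSum _ fun k _ => hint k N
    simp only [h1]
    have hre1 : Integrable (fun x => (X N x * (starRingEnd ℂ) (X N x)).re) ρ := (hint N N).re
    have hre2 : Integrable
        (fun x => (∑ k ∈ Finset.range N, X N x * (starRingEnd ℂ) (X k x)).re) ρ := hcross.re
    rw [integral_add (hre1.fun_add (hsq N)) (hre2.const_mul 2), integral_add hre1 (hsq N),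
      integral_const_mul]
    have h2 : ∫ x, (X N x * (starRingEnd ℂ) (X N x)).re ∂ρ ≤ h 0 := by
      have := integral_re (hint N N)
      simp only [RCLike.re_eq_complex_re] at this
      rw [this]
      exact (Complex.re_le_norm _).trans (by simpa using hcorr N N le_rfl)
    have h3 : ∫ x, (∑ k ∈ Finset.range N, X N x * (starRingEnd ℂ) (X k x)).re ∂ρ ≤
        ∑ d ∈ Finset.range N, h (d + 1) := by
      have := integral_re hcross
      simp only [RCLike.re_eq_complex_re] at this
      rw [this, integral_finsetSum _ fun k _ => hint k N,
        ← Finset.sum_range_reflect (fun d => h (d + 1))]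
      refine (Complex.re_le_norm _).trans (norm_sum_le_of_le _ fun k hk => ?_)
      rw [Finset.mem_range] at hk
      convert hcorr k N hk.le using 2
      omega
    have h4 := Finset.sum_range_succ' h N
    have h5 : ∑ d ∈ Finset.range N, h d ≤ ∑ d ∈ Finset.range (N + 1), h d :=
      Finset.sum_le_sum_of_subset_of_nonneg (Finset.range_mono N.le_succ) fun d _ _ => hh d
    have h6 := mul_le_mul_of_nonneg_left h5 (show (0 : ℝ) ≤ 2 * N by positivity)
    push_cast
    linarith [hh 0]

/-! ## Exponentials -/

theorem HasFourierCoefficients.integral_fourier {ν : Measure ℝ} {e : ℤ → ℝ}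
    (h : HasFourierCoefficients ν e) (m : ℤ) :
    ∫ y : ℝ, fourier m (y : UnitAddCircle) ∂ν = (e m : ℂ) := by
  simp only [← exp_eq_fourier]
  exact h.2.2 m

theorem continuous_fourier_coe (m : ℤ) :
    Continuous fun y : ℝ => (fourier m (y : UnitAddCircle) : ℂ) :=
  (fourier m).continuous.comp (AddCircle.continuous_mk' 1)

theorem norm_fourier_apply (m : ℤ) (y : UnitAddCircle) : ‖(fourier m y : ℂ)‖ = 1 :=
  Circle.norm_coe _

theorem integrable_fourier_coe (ρ : Measure ℝ) [IsFiniteMeasure ρ] (m : ℤ) :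
    Integrable (fun y : ℝ => (fourier m (y : UnitAddCircle) : ℂ)) ρ :=
  Integrable.of_bound (C := 1) (continuous_fourier_coe m).aestronglyMeasurable
    (Eventually.of_forall fun _ => (norm_fourier_apply m _).le)

theorem hasFourierCoefficients_lebesgue :
    HasFourierCoefficients (volume.restrict (Set.Ico (0 : ℝ) 1)) fun m => if m = 0 then 1 else 0 := by
  refine ⟨⟨by simp⟩, ?_, fun m => ?_⟩
  · rw [Measure.restrict_apply measurableSet_Ico.compl]
    simp
  · simp only [exp_eq_fourier]
    rw [restrict_Ico_eq_restrict_Ioc]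
    have := UnitAddCircle.integral_preimage 0 (fourier m)
    rw [zero_add] at this
    rw [this, ThueMorse.integral_fourier]
    split_ifs <;> simp

theorem HasFourierCoefficients.integral_fourier_add_mul_conj {ν : Measure ℝ} {e : ℤ → ℝ}
    (h : HasFourierCoefficients ν e) (c : ℝ) (a b : ℤ) :
    ∫ y : ℝ, (fourier a (y : UnitAddCircle) + (c : ℂ)) *
      (starRingEnd ℂ) (fourier b (y : UnitAddCircle) + (c : ℂ)) ∂ν =
      ((e (a - b) + c * e a + c * e (-b) + c ^ 2 * e 0 : ℝ) : ℂ) := by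
  have := h.1
  have h1 (y : ℝ) : (fourier a (y : UnitAddCircle) + (c : ℂ)) *
      (starRingEnd ℂ) (fourier b (y : UnitAddCircle) + (c : ℂ)) =
      fourier (a - b) (y : UnitAddCircle) + c * fourier a (y : UnitAddCircle) +
        c * fourier (-b) (y : UnitAddCircle) + c ^ 2 * fourier 0 (y : UnitAddCircle) := by
    rw [map_add, Complex.conj_ofReal, sub_eq_add_neg, fourier_add, fourier_neg, fourier_zero]
    ring
  have hi := integrable_fourier_coe ν
  simp only [h1]
  rw [integral_add (((hi _).fun_add ((hi _).const_mul _)).fun_add ((hi _).const_mul _))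
      ((hi _).const_mul _), integral_add ((hi _).fun_add ((hi _).const_mul _)) ((hi _).const_mul _),
    integral_add (hi _) ((hi _).const_mul _), integral_const_mul, integral_const_mul,
    integral_const_mul]
  simp only [h.integral_fourier]
  push_cast
  ring

/-! ## Singularity -/

theorem eta_two_pow_mul (k : ℕ) (m : ℤ) : eta (2 ^ k * m) = eta m := by
  induction k with
  | zero => simp
  | succ k ih => rw [pow_succ', mul_assoc, eta_two_mul, ih]

theorem eta_two_pow (k : ℕ) : eta (2 ^ k) = -1 / 3 := by
  rw [← mul_one ((2 : ℤ) ^ k), eta_two_pow_mul, eta_one]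

theorem eta_two_pow_sub_one (d : ℕ) : eta (2 ^ d - 1) = 1 / 9 + 8 / 9 * (-1 / 2) ^ d := by
  induction d with
  | zero => norm_num [eta_zero]
  | succ d ih =>
    rw [show (2 : ℤ) ^ (d + 1) - 1 = 2 * (2 ^ d - 1) + 1 by ring, eta_two_mul_add_one, ih,
      sub_add_cancel, eta_two_pow, pow_succ]
    ring

/-- The constant `c` centres the lacunary exponentials: it is 1/3 for ν and 0 for Lebesgue measure.
The 4 is twice the geometric sum 2. -/
theorem HasFourierCoefficients.integral_norm_sq_sum_fourier_two_pow_le {ν : Measure ℝ}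
    {e : ℤ → ℝ} (h : HasFourierCoefficients ν e) (c : ℝ)
    (hc : ∀ j k : ℕ, j ≤ k →
      |e (2 ^ k - 2 ^ j) + c * e (2 ^ k) + c * e (-2 ^ j) + c ^ 2 * e 0| ≤ (1 / 2) ^ (k - j))
    (N : ℕ) :
    ∫ y : ℝ, ‖∑ k ∈ Finset.range N, (fourier (2 ^ k) (y : UnitAddCircle) + (c : ℂ))‖ ^ 2 ∂ν ≤
      4 * N := by
  have := h.1
  have h1 := integral_norm_sq_sum_le (ρ := ν)
    (X := fun k y => fourier (2 ^ k) (y : UnitAddCircle) + (c : ℂ)) (h := fun d => (1 / 2) ^ d)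
    (fun k => (continuous_fourier_coe _).add continuous_const)
    (fun k => ⟨1 + ‖(c : ℂ)‖, fun x => (norm_add_le _ _).trans
      (by rw [norm_fourier_apply])⟩)
    (fun j k hjk => by
      simp only [h.integral_fourier_add_mul_conj, Complex.norm_real, Real.norm_eq_abs]
      exact hc j k hjk) N
  refine h1.trans ?_
  have h2 : ∑ d ∈ Finset.range N, (1 / 2 : ℝ) ^ d ≤ 2 :=
    (summable_geometric_two.sum_le_tsum _ fun _ _ => by positivity).trans tsum_geometric_two.le
  have h3 := mul_le_mul_of_nonneg_left h2 (show (0 : ℝ) ≤ 2 * N by positivity)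
  linarith

theorem HasFourierCoefficients.mutuallySingular_volume {ν : Measure ℝ}
    (h : HasFourierCoefficients ν eta) : ν ⟂ₘ (volume : Measure ℝ) := by
  have hν := h.1
  suffices hs : ν ⟂ₘ volume.restrict (Set.Ico (0 : ℝ) 1) by
    rw [← Measure.restrict_add_restrict_compl (μ := (volume : Measure ℝ))
      (measurableSet_Ico (a := (0 : ℝ)) (b := 1)), Measure.MutuallySingular.add_right_iff]
    refine ⟨hs, (Set.Ico (0 : ℝ) 1)ᶜ, measurableSet_Ico.compl, h.2.1, ?_⟩
    rw [Measure.restrict_apply measurableSet_Ico.compl.compl, compl_compl, Set.inter_compl_self,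
      measure_empty]
  -- It remains to show that a measure `ρ` below both is zero.
  refine Measure.mutuallySingular_of_disjoint fun ρ hρ1 hρ2 => ?_
  have hfin : IsFiniteMeasure ρ := isFiniteMeasure_of_le ν hρ1
  have hl := hasFourierCoefficients_lebesgue
  have hlfin := hl.1
  have b1 := h.integral_norm_sq_sum_fourier_two_pow_le (1 / 3) fun j k hjk => by
    have : (2 : ℤ) ^ k - 2 ^ j = 2 ^ j * (2 ^ (k - j) - 1) := by
      rw [mul_sub, ← pow_add, Nat.add_sub_cancel' hjk, mul_one]
    rw [this, eta_two_pow_mul, eta_two_pow_sub_one, eta_neg, eta_two_pow, eta_two_pow, eta_zero,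
      show 1 / 9 + 8 / 9 * (-1 / 2) ^ (k - j) + 1 / 3 * (-1 / 3) + 1 / 3 * (-1 / 3) +
        (1 / 3) ^ 2 * 1 = 8 / 9 * (-1 / 2 : ℝ) ^ (k - j) by ring, abs_mul, abs_pow,
      show |(-1 / 2 : ℝ)| = 1 / 2 by rw [abs_of_neg] <;> norm_num]
    refine mul_le_of_le_one_left (by positivity) ?_
    rw [abs_of_pos] <;> norm_num
  have b2 := hl.integral_norm_sq_sum_fourier_two_pow_le 0 fun j k hjk => by
    rcases hjk.eq_or_lt with rfl | hlt
    · simp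
    · have : (2 : ℤ) ^ k - 2 ^ j ≠ 0 := by
        rw [sub_ne_zero]
        exact (pow_lt_pow_right₀ (by norm_num) hlt).ne'
      simp [this]
  let S (c : ℝ) (N : ℕ) (y : ℝ) : ℂ :=
    ∑ k ∈ Finset.range N, (fourier (2 ^ k) (y : UnitAddCircle) + (c : ℂ))
  have hS (c : ℝ) (N : ℕ) (τ : Measure ℝ) [IsFiniteMeasure τ] :
      Integrable (fun y => ‖S c N y‖ ^ 2) τ := by
    refine Integrable.of_bound (C := (N * (1 + ‖(c : ℂ)‖)) ^ 2)
      (Continuous.aestronglyMeasurable ?_) (Eventually.of_forall fun y => ?_)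
    · have := fun k : ℕ => continuous_fourier_coe (2 ^ k)
      simp only [S]
      fun_prop
    · rw [norm_pow, norm_norm]
      refine pow_le_pow_left₀ (norm_nonneg _) ?_ 2
      have hk (k : ℕ) (_ : k ∈ Finset.range N) :
          ‖fourier (2 ^ k) (y : UnitAddCircle) + (c : ℂ)‖ ≤ 1 + ‖(c : ℂ)‖ :=
        (norm_add_le _ _).trans (by rw [norm_fourier_apply])
      refine (norm_sum_le_of_le _ hk).trans ?_
      rw [Finset.sum_const, Finset.card_range, nsmul_eq_mul]
  -- The two sums differ by the constant `N / 3`, so they cannot both be small. Each has square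
  -- integral at most `4 * N` under `ρ`, whence 144 = 9 * (2 * 4 + 2 * 4).
  have bound (N : ℕ) : (N : ℝ) * ρ.real Set.univ ≤ 144 := by
    rcases N.eq_zero_or_pos with rfl | hN
    · simp
    have hN' : (0 : ℝ) < N := by exact_mod_cast hN
    have hpt (y : ℝ) : (N : ℝ) ^ 2 / 9 ≤ 2 * ‖S (1 / 3) N y‖ ^ 2 + 2 * ‖S 0 N y‖ ^ 2 := by
      have h1 : S (1 / 3) N y - S 0 N y = ((N / 3 : ℝ) : ℂ) := by
        simp only [S, Finset.sum_add_distrib, Finset.sum_const, Finset.card_range, nsmul_eq_mul]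
        push_cast
        ring
      have h2 := norm_sub_le (S (1 / 3) N y) (S 0 N y)
      rw [h1, Complex.norm_real, Real.norm_of_nonneg (by positivity)] at h2
      nlinarith [sq_nonneg (‖S (1 / 3) N y‖ - ‖S 0 N y‖), norm_nonneg (S (1 / 3) N y),
        norm_nonneg (S 0 N y)]
    have h1 := integral_mono (μ := ρ) (integrable_const _)
      (((hS (1 / 3) N ρ).const_mul 2).fun_add ((hS 0 N ρ).const_mul 2)) hpt
    rw [integral_add ((hS (1 / 3) N ρ).const_mul 2) ((hS 0 N ρ).const_mul 2), integral_const_mul,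
      integral_const_mul, integral_const, smul_eq_mul] at h1
    have h2 := integral_mono_measure hρ1 (Eventually.of_forall fun y => by positivity)
      (hS (1 / 3) N ν)
    have h3 := integral_mono_measure hρ2 (Eventually.of_forall fun y => by positivity)
      (hS 0 N (volume.restrict (Set.Ico (0 : ℝ) 1)))
    have h4 : (N : ℝ) * (N * ρ.real Set.univ) ≤ N * 144 := by
      linarith [b1 N, b2 N]
    exact le_of_mul_le_mul_left h4 hN'
  have hzero : ρ.real Set.univ = 0 := by
    by_contra hne
    have hpos : 0 < ρ.real Set.univ := lt_of_le_of_ne measureReal_nonneg (Ne.symm hne)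
    obtain ⟨N, hN⟩ := exists_nat_gt (144 / ρ.real Set.univ)
    rw [div_lt_iff₀ hpos] at hN
    linarith [bound N]
  rw [measureReal_eq_zero_iff] at hzero
  exact (Measure.measure_univ_eq_zero.1 hzero).le

/-! ## Continuity -/

theorem sum_range_four_mul (f : ℕ → ℝ) (N : ℕ) :
    ∑ n ∈ Finset.range (4 * N), f n = ∑ k ∈ Finset.range N,
      (f (4 * k) + f (4 * k + 1) + f (4 * k + 2) + f (4 * k + 3)) := by
  induction N with
  | zero => simp
  | succ N ih =>
    rw [Finset.sum_range_succ, ← ih, show 4 * (N + 1) = 4 * N + 1 + 1 + 1 + 1 by ring]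
    simp only [Finset.sum_range_succ]
    ring

/-- With a = η(k), b = η(k+1), a block of four contributes |a| + (|a-b| + |a+b|)/2 = |a| + max(|a|,
|b|). The triangle inequality after a single doubling would give only the factor 2, no gain over the
length; two doublings give 3 against 4. -/
theorem sum_abs_eta_four_mul_le (N : ℕ) :
    ∑ d ∈ Finset.range (4 * N), |eta d| ≤ 3 * ∑ d ∈ Finset.range N, |eta d| := by
  have h1 (k : ℕ) : |eta (4 * k : ℕ)| + |eta (4 * k + 1 : ℕ)| + |eta (4 * k + 2 : ℕ)| +
      |eta (4 * k + 3 : ℕ)| ≤ 2 * |eta k| + |eta (k + 1 : ℕ)| := by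
    have e0 : eta (4 * k : ℕ) = eta k := by
      rw [show ((4 * k : ℕ) : ℤ) = 2 * (2 * k) by push_cast; ring, eta_two_mul, eta_two_mul]
    have e1 : eta (4 * k + 1 : ℕ) = (eta (k + 1 : ℕ) - eta k) / 4 := by
      rw [show ((4 * k + 1 : ℕ) : ℤ) = 2 * (2 * k) + 1 by push_cast; ring, eta_two_mul_add_one,
        eta_two_mul_add_one, eta_two_mul]
      push_cast; ring
    have e2 : eta (4 * k + 2 : ℕ) = -(eta k + eta (k + 1 : ℕ)) / 2 := by
      rw [show ((4 * k + 2 : ℕ) : ℤ) = 2 * (2 * k + 1) by push_cast; ring, eta_two_mul,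
        eta_two_mul_add_one]
      push_cast; ring
    have e3 : eta (4 * k + 3 : ℕ) = (eta k - eta (k + 1 : ℕ)) / 4 := by
      rw [show ((4 * k + 3 : ℕ) : ℤ) = 2 * (2 * k + 1) + 1 by push_cast; ring,
        eta_two_mul_add_one, show (2 * (k : ℤ) + 1 + 1) = 2 * (k + 1) by ring, eta_two_mul,
        eta_two_mul_add_one]
      push_cast; ring
    rw [e0, e1, e2, e3]
    generalize eta k = a
    generalize eta (k + 1 : ℕ) = b
    rcases abs_cases a with ⟨ha, _⟩ | ⟨ha, _⟩ <;> rcases abs_cases b with ⟨hb, _⟩ | ⟨hb, _⟩ <;>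
      rcases abs_cases ((b - a) / 4) with ⟨h1, _⟩ | ⟨h1, _⟩ <;>
      rcases abs_cases (-(a + b) / 2) with ⟨h2, _⟩ | ⟨h2, _⟩ <;>
      rcases abs_cases ((a - b) / 4) with ⟨h3, _⟩ | ⟨h3, _⟩ <;>
      rw [ha, hb, h1, h2, h3] <;> linarith
  have h2 := Finset.sum_range_succ (fun d : ℕ => |eta d|) N
  have h3 := Finset.sum_range_succ' (fun d : ℕ => |eta d|) N
  have h4 : |eta ((0 : ℕ) : ℤ)| = 1 := by simp [eta_zero]
  -- Shifting the summation index trades |η(0)| = 1 for |η(N)| ≤ 1, so the shifted sum is no larger.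
  have h5 := abs_eta_le_one N
  rw [sum_range_four_mul (fun d : ℕ => |eta d|)]
  refine (Finset.sum_le_sum fun k _ => h1 k).trans ?_
  rw [Finset.sum_add_distrib, ← Finset.mul_sum]
  linarith

theorem sum_abs_eta_le (k : ℕ) : ∑ d ∈ Finset.range (4 ^ k), |eta d| ≤ 3 ^ k := by
  induction k with
  | zero => simp [eta_zero]
  | succ k ih =>
    rw [pow_succ', pow_succ']
    exact (sum_abs_eta_four_mul_le _).trans (by linarith)

/-- A Wiener-type bound: the exponentials normalised to be 1 at `y` sum to `N` there, so their
square integral is at least `N ^ 2` times the mass of the point. -/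
theorem HasFourierCoefficients.mul_measureReal_singleton_le {ν : Measure ℝ} {e : ℤ → ℝ}
    (h : HasFourierCoefficients ν e) (y : ℝ) (N : ℕ) :
    N * ν.real {y} ≤ 2 * ∑ d ∈ Finset.range N, |e d| := by
  have := h.1
  rcases N.eq_zero_or_pos with rfl | hN
  · simp
  have hN' : (0 : ℝ) < N := by exact_mod_cast hN
  let X (k : ℕ) (x : ℝ) : ℂ := fourier k (x : UnitAddCircle) * fourier (-k) (y : UnitAddCircle)
  have hXc (k : ℕ) : Continuous (X k) := (continuous_fourier_coe _).mul continuous_const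
  have hXn (k : ℕ) (x : ℝ) : ‖X k x‖ = 1 := by
    simp only [X, norm_mul, norm_fourier_apply, mul_one]
  have h1 := integral_norm_sq_sum_le (ρ := ν) (X := X) (h := fun d => |e d|) hXc
    (fun k => ⟨1, fun x => (hXn k x).le⟩) (fun j k hjk => by
      have h2 (x : ℝ) : X k x * (starRingEnd ℂ) (X j x) =
          fourier (k - j : ℕ) (x : UnitAddCircle) * fourier (-(k - j : ℕ)) (y : UnitAddCircle) := by
        simp only [X, map_mul, ← fourier_neg]
        rw [Nat.cast_sub hjk, sub_eq_add_neg, fourier_add, neg_add, fourier_add]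
        ring
      simp only [h2]
      rw [integral_mul_const, h.integral_fourier, norm_mul, norm_fourier_apply, mul_one,
        Complex.norm_real, Real.norm_eq_abs]) N
  have h2 : ∫ x in {y}, ‖∑ k ∈ Finset.range N, X k x‖ ^ 2 ∂ν ≤
      ∫ x, ‖∑ k ∈ Finset.range N, X k x‖ ^ 2 ∂ν := by
    refine setIntegral_le_integral ?_ (Eventually.of_forall fun x => by positivity)
    refine Integrable.of_bound (C := (N : ℝ) ^ 2) (Continuous.aestronglyMeasurable (by fun_prop))
      (Eventually.of_forall fun x => ?_)
    rw [norm_pow, norm_norm]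
    refine pow_le_pow_left₀ (norm_nonneg _) ?_ 2
    refine (norm_sum_le_of_le _ fun k _ => (hXn k x).le).trans ?_
    simp
  have h3 (k : ℕ) : X k y = 1 := by
    simp only [X, ← fourier_add, add_neg_cancel, fourier_zero]
  rw [integral_singleton] at h2
  simp only [h3, Finset.sum_const, Finset.card_range, nsmul_eq_mul, mul_one, smul_eq_mul,
    Complex.norm_natCast] at h2
  have h4 : (N : ℝ) * (N * ν.real {y}) ≤ N * (2 * ∑ d ∈ Finset.range N, |e d|) := by
    linarith
  exact le_of_mul_le_mul_left h4 hN'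

theorem HasFourierCoefficients.measure_singleton {ν : Measure ℝ}
    (h : HasFourierCoefficients ν eta) (y : ℝ) : ν {y} = 0 := by
  have := h.1
  have h1 (k : ℕ) : ν.real {y} ≤ 2 * (3 / 4) ^ k := by
    have h2 := h.mul_measureReal_singleton_le y (4 ^ k)
    have h3 := sum_abs_eta_le k
    have h4 : (0 : ℝ) < 4 ^ k := by positivity
    push_cast at h2
    rw [div_pow, mul_div_assoc', le_div_iff₀ h4]
    linarith
  have h5 : Tendsto (fun k : ℕ => 2 * (3 / 4 : ℝ) ^ k) atTop (𝓝 0) := by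
    simpa using (tendsto_pow_atTop_nhds_zero_of_lt_one (by norm_num) (by norm_num)).const_mul
      (2 : ℝ) (f := fun k : ℕ => (3 / 4 : ℝ) ^ k)
  have h6 := ge_of_tendsto' h5 h1
  rw [← measureReal_eq_zero_iff]
  exact le_antisymm h6 measureReal_nonneg

/-! ## Periodisation of a measure on `[0, 1)` -/

instance : SFinite deltaZ := by
  unfold deltaZ
  infer_instance

theorem conv_deltaZ (ν : Measure ℝ) :
    ν ∗ deltaZ = Measure.sum fun n : ℤ => ν.map fun x : ℝ => x + n := by
  refine Measure.ext_of_lintegral _ fun f hf => ?_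
  rw [Measure.lintegral_conv hf, lintegral_sum_measure]
  simp only [deltaZ, lintegral_sum_measure, lintegral_dirac]
  rw [lintegral_tsum fun n => (by fun_prop)]
  refine tsum_congr fun n => ?_
  rw [lintegral_map hf (by fun_prop)]

theorem conv_deltaZ_apply (ν : Measure ℝ) {s : Set ℝ} (hs : MeasurableSet s) :
    (ν ∗ deltaZ) s = ∑' n : ℤ, ν ((fun x : ℝ => x + n) ⁻¹' s) := by
  rw [conv_deltaZ, Measure.sum_apply _ hs]
  exact tsum_congr fun n => Measure.map_apply (by fun_prop) hs

theorem map_add_conv_deltaZ (ν : Measure ℝ) (k : ℤ) :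
    (ν ∗ deltaZ).map (fun x : ℝ => x + k) = ν ∗ deltaZ := by
  have hk : Measurable fun x : ℝ => x + k := by fun_prop
  ext s hs
  rw [Measure.map_apply hk hs, conv_deltaZ_apply ν (hk hs), conv_deltaZ_apply ν hs]
  refine Eq.trans (tsum_congr fun n => congrArg ν ?_)
    ((Equiv.addRight k).tsum_eq fun n : ℤ => ν ((fun x : ℝ => x + n) ⁻¹' s))
  ext x
  simp [add_assoc]

/-- The translates of the half-open interval are disjoint, so only `n = 0` contributes. -/
theorem restrict_conv_deltaZ {ν : Measure ℝ} (hν : ν (Set.Ico (0 : ℝ) 1)ᶜ = 0) :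
    (ν ∗ deltaZ).restrict (Set.Ico (0 : ℝ) 1) = ν := by
  ext s hs
  have hs' : MeasurableSet (s ∩ Set.Ico (0 : ℝ) 1) := hs.inter measurableSet_Ico
  rw [Measure.restrict_apply hs, conv_deltaZ_apply ν hs', tsum_eq_single 0]
  · simp only [Int.cast_zero, add_zero, Set.preimage_id']
    exact measure_inter_conull hν
  · intro n hn
    refine measure_mono_null (fun x hx => ?_) hν
    rw [Set.mem_compl_iff]
    intro hx'
    refine hn ?_
    have h1 := hx.2
    simp only [Set.mem_Ico] at h1 hx'
    have h2 : (n : ℝ) < 1 := by linarith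
    have h3 : (-1 : ℝ) < n := by linarith
    have h2 : n < 1 := by exact_mod_cast h2
    have h3 : -1 < n := by exact_mod_cast h3
    omega

theorem IsPurelySingularContinuous.conv_deltaZ {ν : Measure ℝ}
    (h : IsPurelySingularContinuous ν) : IsPurelySingularContinuous (ν ∗ deltaZ) := by
  refine ⟨fun x => ?_, ?_⟩
  · rw [conv_deltaZ_apply ν (measurableSet_singleton x), ENNReal.tsum_eq_zero]
    intro n
    convert h.1 (x - n) using 2
    ext y
    simp only [Set.mem_preimage, Set.mem_singleton_iff, eq_sub_iff_add_eq]
  · rw [ThueMorse.conv_deltaZ, Measure.MutuallySingular.sum_left]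
    intro n
    obtain ⟨s, hs, h1, h2⟩ := h.2
    have hm : Measurable fun x : ℝ => x + -(n : ℝ) := by fun_prop
    refine ⟨(fun x : ℝ => x + -(n : ℝ)) ⁻¹' s, hm hs, ?_, ?_⟩
    · rw [Measure.map_apply (by fun_prop) (hm hs), ← Set.preimage_comp]
      convert h1 using 2
      ext x
      simp
    · rw [← Set.preimage_compl, measure_preimage_add_right, h2]

/-! ## Fourier transforms of periodic measures -/

/-- A summable majorant of the translates, uniform on [0,1), that justifies every exchange of sum
and integral below. -/
theorem exists_norm_schwartz_le (φ : 𝓢(ℝ, ℂ)) :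
    ∃ b : ℤ → ℝ, Summable b ∧ ∀ x ∈ Set.Ico (0 : ℝ) 1, ∀ n : ℤ, ‖φ (x + n)‖ ≤ b n := by
  obtain ⟨C, hC⟩ : ∃ C : ℝ, ∀ x : ℝ, (1 + ‖x‖) ^ 2 * ‖φ x‖ ≤ C :=
    ⟨_, fun x => by
      simpa using SchwartzMap.one_add_le_sup_seminorm_apply (𝕜 := ℝ) (m := (2, 0)) (k := 2) (n := 0)
        le_rfl le_rfl φ x⟩
  have hC0 : 0 ≤ C := le_trans (by positivity) (hC 0)
  refine ⟨fun n => 4 * C * (1 / (1 + |(n : ℝ)|) ^ 2), ?_, fun x hx n => ?_⟩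
  · refine Summable.mul_left _ ?_
    have h1 : Summable fun n : ℕ => 1 / (1 + |(n : ℝ)|) ^ 2 := by
      have := (summable_nat_add_iff 1).2 (Real.summable_one_div_nat_pow.2 one_lt_two)
      refine (summable_congr fun n => ?_).2 this
      push_cast
      rw [Nat.abs_cast, add_comm]
    refine Summable.of_nat_of_neg ?_ ?_
    · simpa using h1
    · simpa using h1
  · have h1 : 1 + |(n : ℝ)| ≤ 2 * (1 + ‖x + n‖) := by
      have h2 : |(n : ℝ)| ≤ |x + n| + |x| := by
        simpa using abs_sub (x + n) x
      have h3 : |x| ≤ 1 := abs_le.2 ⟨by linarith [hx.1], hx.2.le⟩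
      rw [Real.norm_eq_abs]
      linarith [abs_nonneg (x + n)]
    have h2 := hC (x + n)
    have h3 : (1 + |(n : ℝ)|) ^ 2 ≤ 4 * (1 + ‖x + n‖) ^ 2 := by
      calc (1 + |(n : ℝ)|) ^ 2 ≤ (2 * (1 + ‖x + n‖)) ^ 2 := by gcongr
        _ = _ := by ring
    beta_reduce
    rw [mul_one_div, le_div_iff₀ (by positivity)]
    calc ‖φ (x + n)‖ * (1 + |(n : ℝ)|) ^ 2 ≤ ‖φ (x + n)‖ * (4 * (1 + ‖x + n‖) ^ 2) := by gcongr
      _ ≤ 4 * C := by linarith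

theorem summable_norm_schwartz_int (φ : 𝓢(ℝ, ℂ)) : Summable fun n : ℤ => ‖φ (n : ℝ)‖ := by
  obtain ⟨b, hb, h⟩ := exists_norm_schwartz_le φ
  refine Summable.of_nonneg_of_le (fun n => norm_nonneg _) (fun n => ?_) hb
  simpa using h 0 (by simp) n

theorem integrable_schwartz_conv_deltaZ {ν : Measure ℝ} [IsFiniteMeasure ν]
    (hν : ν (Set.Ico (0 : ℝ) 1)ᶜ = 0) (φ : 𝓢(ℝ, ℂ)) :
    Integrable (fun x => φ x) (ν ∗ deltaZ) := by
  obtain ⟨b, hb, h⟩ := exists_norm_schwartz_le φ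
  refine ⟨φ.continuous.aestronglyMeasurable, ?_⟩
  rw [HasFiniteIntegral, conv_deltaZ, lintegral_sum_measure]
  have h1 (n : ℤ) : ∫⁻ x, ‖φ x‖ₑ ∂(ν.map fun x : ℝ => x + n) ≤
      ENNReal.ofReal (b n) * ν Set.univ := by
    rw [lintegral_map φ.continuous.enorm.measurable (by fun_prop), ← lintegral_const]
    refine lintegral_mono_ae ?_
    filter_upwards [mem_ae_iff.2 hν] with x hx
    rw [← ofReal_norm]
    exact ENNReal.ofReal_le_ofReal (h x hx n)
  refine (ENNReal.tsum_le_tsum h1).trans_lt ?_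
  rw [ENNReal.tsum_mul_right]
  exact ENNReal.mul_lt_top hb.tsum_ofReal_lt_top (measure_lt_top _ _)

theorem HasFourierCoefficients.isCombFourierTransform {ν : Measure ℝ} {e : ℤ → ℝ}
    (hν : HasFourierCoefficients ν e) : IsCombFourierTransform e (ν ∗ deltaZ) := by
  have hfin := hν.1
  intro φ
  have hφ := integrable_schwartz_conv_deltaZ hν.2.1 φ
  refine ⟨hφ, ?_⟩
  obtain ⟨b, hb, h⟩ := exists_norm_schwartz_le φ
  have hIco : ∀ᵐ x ∂ν, x ∈ Set.Ico (0 : ℝ) 1 := mem_ae_iff.2 hν.2.1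
  have hn (n : ℤ) : ∀ᵐ x ∂ν, ‖φ (x + n)‖ ≤ b n := by
    filter_upwards [hIco] with x hx using h x hx n
  have hint (n : ℤ) : Integrable (fun x : ℝ => φ (x + n)) ν :=
    Integrable.of_bound (C := b n)
      (φ.continuous.comp (continuous_add_const _)).aestronglyMeasurable (hn n)
  have h1 : ∫ x, φ x ∂(ν ∗ deltaZ) = ∫ x : ℝ, ∑' n : ℤ, φ (x + n) ∂ν := by
    have hs := hasSum_integral_measure (by rwa [← conv_deltaZ] :
      Integrable (fun x => φ x) (Measure.sum fun n : ℤ => ν.map fun x : ℝ => x + n))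
    rw [← conv_deltaZ] at hs
    have hm (n : ℤ) : ∫ x, φ x ∂(ν.map fun x : ℝ => x + n) = ∫ x : ℝ, φ (x + n) ∂ν :=
      integral_map (by fun_prop) φ.continuous.aestronglyMeasurable
    simp only [hm] at hs
    refine hs.unique (hasSum_integral_of_summable_integral_norm hint ?_)
    refine Summable.of_nonneg_of_le (fun n => integral_nonneg fun _ => norm_nonneg _)
      (fun n => ?_) (hb.mul_right (ν.real Set.univ))
    refine (integral_mono_ae (hint n).norm (integrable_const (b n)) (hn n)).trans ?_
    rw [integral_const, smul_eq_mul, mul_comm]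
  have h2 := hasSum_integral_of_summable_integral_norm (μ := ν)
    (F := fun (m : ℤ) (x : ℝ) => 𝓕 φ (m : ℝ) * fourier m (x : UnitAddCircle))
    (fun m => (integrable_fourier_coe ν m).const_mul _) (by
      simp only [norm_mul, norm_fourier_apply, mul_one, integral_const, smul_eq_mul]
      exact (summable_norm_schwartz_int (𝓕 φ)).mul_left _)
  rw [h1]
  -- Poisson summation turns the periodisation of `φ` into its Fourier series, which is then
  -- integrated against ν term by term.
  simp only [SchwartzMap.tsum_eq_tsum_fourier]
  simp only [integral_const_mul, hν.integral_fourier, mul_comm _ (Complex.ofReal _)] at h2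
  exact h2

/-- A smooth bump equal to 1 on a ball is a Schwartz function, and its assumed integrability bounds
the mass of the ball. -/
theorem IsCombFourierTransform.isLocallyFiniteMeasure {e : ℤ → ℝ} {μ : Measure ℝ}
    (h : IsCombFourierTransform e μ) : IsLocallyFiniteMeasure μ := by
  refine ⟨fun x => ⟨Metric.closedBall x 1, Metric.closedBall_mem_nhds x one_pos, ?_⟩⟩
  let f : ContDiffBump x := ⟨1, 2, one_pos, one_lt_two⟩
  have hf : HasCompactSupport fun y => (f y : ℂ) :=
    f.hasCompactSupport.comp_left Complex.ofReal_zero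
  let φ : 𝓢(ℝ, ℂ) := hf.toSchwartzMap (Complex.ofRealCLM.contDiff.comp f.contDiff)
  refine (measure_mono fun y hy => ?_).trans_lt ((h φ).1.measure_norm_ge_lt_top one_pos)
  have h1 : φ y = (f y : ℂ) := rfl
  rw [Set.mem_ofPred_eq, h1, f.one_of_mem_closedBall hy]
  simp

theorem tendsto_smoothTransition_mul (t : ℝ) :
    Tendsto (fun k : ℕ => Real.smoothTransition (k * t)) atTop (𝓝 (if 0 < t then 1 else 0)) := by
  split_ifs with ht
  · refine tendsto_const_nhds.congr' ?_
    filter_upwards [(tendsto_natCast_atTop_atTop.atTop_mul_const ht).eventually_ge_atTop 1] with k hk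
    exact (Real.smoothTransition.one_of_one_le hk).symm
  · refine tendsto_const_nhds.congr fun k => ?_
    rw [Real.smoothTransition.zero_of_nonpos]
    exact mul_nonpos_of_nonneg_of_nonpos k.cast_nonneg (not_lt.1 ht)

/-- Composing `Real.smoothTransition` with multiples of a smooth function that is positive exactly
on an open interval gives test functions converging to the indicator of that interval. -/
theorem IsCombFourierTransform.eq {e : ℤ → ℝ} {μ μ' : Measure ℝ}
    (h : IsCombFourierTransform e μ) (h' : IsCombFourierTransform e μ') : μ = μ' := by
  have hμ := h.isLocallyFiniteMeasure
  have hμ' := h'.isLocallyFiniteMeasure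
  refine Real.measure_ext_Ioo_rat fun a b => ?_
  set s := Set.Ioo (a : ℝ) b with hs
  obtain ⟨f, hf, hfs, hfr⟩ := (isOpen_Ioo (a := (a : ℝ)) (b := b)).exists_contDiff_support_eq
    (n := ⊤)
  have hf0 (x : ℝ) : 0 ≤ f x := (hfr ⟨x, rfl⟩).1
  have hfpos (x : ℝ) : 0 < f x ↔ x ∈ s := by
    rw [hs, ← hf, Function.mem_support]
    exact ⟨ne_of_gt, fun hx => lt_of_le_of_ne (hf0 x) (Ne.symm hx)⟩
  let g (k : ℕ) (x : ℝ) : ℂ := (Real.smoothTransition (k * f x) : ℂ)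
  have hgsupp (k : ℕ) : HasCompactSupport (g k) := by
    refine HasCompactSupport.intro (isCompact_Icc (a := (a : ℝ)) (b := b)) fun x hx => ?_
    have : ¬ 0 < f x := fun hx' => hx (Set.Ioo_subset_Icc_self ((hfpos x).1 hx'))
    have : f x = 0 := le_antisymm (not_lt.1 this) (hf0 x)
    simp [g, this]
  have hgdiff (k : ℕ) : ContDiff ℝ (⊤ : ℕ∞) (g k) :=
    Complex.ofRealCLM.contDiff.comp (Real.smoothTransition.contDiff.comp (contDiff_const.mul hfs))
  have key (ρ : Measure ℝ) [IsLocallyFiniteMeasure ρ] :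
      Tendsto (fun k => ∫ x, g k x ∂ρ) atTop (𝓝 (ρ.real s : ℂ)) := by
    have hlim : ((ρ.real s : ℝ) : ℂ) = ∫ x, s.indicator (fun _ => (1 : ℂ)) x ∂ρ := by
      rw [integral_indicator measurableSet_Ioo, setIntegral_const]
      simp [hs]
    rw [hlim]
    refine tendsto_integral_of_dominated_convergence (s.indicator fun _ => (1 : ℝ))
      (fun k => (hgdiff k).continuous.aestronglyMeasurable) ?_
      (fun k => Eventually.of_forall fun x => ?_) (Eventually.of_forall fun x => ?_)
    · rw [integrable_indicator_iff measurableSet_Ioo]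
      exact integrableOn_const (measure_Ioo_lt_top.ne)
    · simp only [g, Complex.norm_real, Real.norm_of_nonneg (Real.smoothTransition.nonneg _)]
      by_cases hx : x ∈ s
      · rw [Set.indicator_of_mem hx]
        exact Real.smoothTransition.le_one _
      · rw [Set.indicator_of_notMem hx]
        have : ¬ 0 < f x := fun hx' => hx ((hfpos x).1 hx')
        refine (Real.smoothTransition.zero_of_nonpos ?_).le
        exact mul_nonpos_of_nonneg_of_nonpos k.cast_nonneg (not_lt.1 this)
    · have h1 := (Complex.continuous_ofReal.tendsto _).comp (tendsto_smoothTransition_mul (f x))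
      have h2 : s.indicator (fun _ => (1 : ℂ)) x = ((if 0 < f x then 1 else 0 : ℝ) : ℂ) := by
        simp only [hfpos, Set.indicator_apply]
        split_ifs <;> simp
      rw [h2]
      exact h1
  have heq (k : ℕ) : ∫ x, g k x ∂μ = ∫ x, g k x ∂μ' :=
    (h ((hgsupp k).toSchwartzMap (hgdiff k))).2.unique
      (h' ((hgsupp k).toSchwartzMap (hgdiff k))).2
  have h1 := key μ
  simp only [heq] at h1
  have h2 : μ.real s = μ'.real s := by exact_mod_cast tendsto_nhds_unique h1 (key μ')
  exact (measureReal_eq_measureReal_iff measure_Ioo_lt_top.ne measure_Ioo_lt_top.ne).1 h2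

end ThueMorse

end

theorem mainTheorem1 :
    (∀ x ∈ ThueMorse.hull,
      (∀ m : ℤ,
        Tendsto (ThueMorse.pairAverage (ThueMorse.weight x) m) atTop (𝓝 (ThueMorse.eta m)) ∧
        Tendsto (ThueMorse.siteAverage (ThueMorse.weight x) m) atTop (𝓝 (ThueMorse.eta m))) ∧
      ThueMorse.IsAutocorrelation (ThueMorse.weight x) ThueMorse.eta) ∧
    ∃ ν : Measure ℝ,
      ThueMorse.HasFourierCoefficients ν ThueMorse.eta ∧
      (∀ ν' : Measure ℝ, ThueMorse.HasFourierCoefficients ν' ThueMorse.eta → ν' = ν) ∧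
      ν ≠ 0 ∧
      ThueMorse.IsPurelySingularContinuous ν ∧
      ThueMorse.IsCombFourierTransform ThueMorse.eta (ν ∗ ThueMorse.deltaZ) ∧
      (∀ μ : Measure ℝ, ThueMorse.IsCombFourierTransform ThueMorse.eta μ →
        μ = ν ∗ ThueMorse.deltaZ) ∧
      (ν ∗ ThueMorse.deltaZ).restrict (Set.Ico (0 : ℝ) 1) = ν ∧
      IsLocallyFiniteMeasure (ν ∗ ThueMorse.deltaZ) ∧
      (∀ n : ℤ, (ν ∗ ThueMorse.deltaZ).map (fun x : ℝ => x + n) = ν ∗ ThueMorse.deltaZ) ∧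
      ThueMorse.IsPurelySingularContinuous (ν ∗ ThueMorse.deltaZ) := by
  refine ⟨fun x hx => ⟨fun m => ⟨ThueMorse.tendsto_pairAverage hx m,
    ThueMorse.tendsto_siteAverage hx m⟩,
    ThueMorse.isAutocorrelation_of_tendsto_pairAverage (ThueMorse.tendsto_pairAverage hx)⟩, ?_⟩
  obtain ⟨ν, hν⟩ := ThueMorse.exists_hasFourierCoefficients_eta
  have hsing : ThueMorse.IsPurelySingularContinuous ν :=
    ⟨hν.measure_singleton, hν.mutuallySingular_volume⟩
  have hcomb := hν.isCombFourierTransform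
  refine ⟨ν, hν, fun ν' hν' => hν'.eq hν, ?_, hsing, hcomb, fun μ hμ => hμ.eq hcomb,
    ThueMorse.restrict_conv_deltaZ hν.2.1, hcomb.isLocallyFiniteMeasure,
    ThueMorse.map_add_conv_deltaZ ν, hsing.conv_deltaZ⟩
  -- The total mass of ν is η(0) = 1.
  rintro rfl
  have h := hν.2.2 0
  rw [integral_zero_measure, ThueMorse.eta_zero] at h
  norm_num at h
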